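/- Let $n\ge 2$ and let $B_\rho=\{x\in\mathbb R^n:|x|<\rho\}$. For $0<r<R$ let $S_{r,R}$ be the class of sets $\Omega\subset B_R$ that are star-shaped with respect to every point of $B_r$ (so that $B_r\subset\Omega$, and for all $y\in B_r$ and $x\in\Omega$ the segment $[y,x]$ lies in $\Omega$). Write $\mathrm{Per}(\Omega)=\sup\{\int_\Omega \operatorname{div}\varphi\,dx:\varphi\in C^1_c(\mathbb R^n;\mathbb R^n),\ |\varphi|\le 1\}$ for the perimeter, $d_H$ for the Hausdorff distance, $\sigma=\mathcal H^{n-1}$ for the surface measure, and $H$ for the mean curvature (the sum of the principal curvatures, i.e. the divergence of the outward unit normal). For all $0<r<R$, $T>0$ and $\mathcal W<\infty$ there is a constant $\overline m=\overline m(n,r,R,T,\mathcal W)>0$ with the following property. Let $(\Omega^1_t)_{0\le t\le T}$ and $(\Omega^2_t)_{0\le t\le T}$ be two families of sets in $S_{r,R}$ such that, for $j=1,2$, the boundary $\partial\Omega^j_t$ is a $C^\infty$ hypersurface for every $0<t\le T$, the function $t\mapsto \mathrm{Per}(\Omega^j_t)$ is measurable on $(0,T]$, and $$\int_0^T\int_{\partial\Omega^j_t}H^2\,d\sigma\,dt<\mathcal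 W .$$ Then $\mathrm{Per}(\Omega^j_t)<\infty$ for every $0<t\le T$ and $t\mapsto\mathrm{Per}(\Omega^j_t)$ is integrable on $(0,T)$ for $j=1,2$, and $$\left(\int_0^T\big(\mathrm{Per}(\Omega^1_t)-\mathrm{Per}(\Omega^2_t)\big)\,dt\right)^2\le \overline m\,\sup_{t\in[0,T]}d_H(\Omega^1_t,\Omega^2_t).$$ -/

import Mathlib

open MeasureTheory Set
open scoped ContDiff ENNReal Topology Gradient

/-- `Ω` is star-shaped with respect to the ball `B_r(0)`: it is bounded and star-shaped with respect
to each point of that ball. (A set that is star-shaped with respect to a point contains the point;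
Mathlib's `StarConvex` alone would also admit the empty set.) -/
def IsStarShapedBall {n : ℕ} (r : ℝ) (Ω : Set (EuclideanSpace ℝ (Fin n))) : Prop :=
  Bornology.IsBounded Ω ∧ ∀ y ∈ Metric.ball (0 : EuclideanSpace ℝ (Fin n)) r,
    y ∈ Ω ∧ StarConvex ℝ y Ω

/-- The class `S_{r,R}` of sets that are star-shaped with respect to `B_r(0)` and contained in
`B_R(0)`. -/
def starClass (n : ℕ) (r R : ℝ) : Set (Set (EuclideanSpace ℝ (Fin n))) :=
  {Ω | IsStarShapedBall r Ω ∧ Ω ⊆ Metric.ball 0 R}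

/-- The divergence `∑ᵢ ∂ᵢ φᵢ` of a vector field on `ℝⁿ`. -/
noncomputable def vectorDiv {n : ℕ} (φ : EuclideanSpace ℝ (Fin n) → EuclideanSpace ℝ (Fin n))
    (x : EuclideanSpace ℝ (Fin n)) : ℝ :=
  ∑ i : Fin n, (fderiv ℝ φ x (EuclideanSpace.single i 1)) i

/-- The (De Giorgi) perimeter
`Per(Ω) = sup {∫_Ω div φ : φ ∈ C¹_c(ℝⁿ; ℝⁿ), sup |φ| ≤ 1}`, as an element of `[0, ∞]`. -/
noncomputable def perimeter {n : ℕ} (Ω : Set (EuclideanSpace ℝ (Fin n))) : ℝ≥0∞ :=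
  ⨆ (φ : EuclideanSpace ℝ (Fin n) → EuclideanSpace ℝ (Fin n)) (_ : ContDiff ℝ 1 φ)
    (_ : HasCompactSupport φ) (_ : ∀ x, ‖φ x‖ ≤ 1),
    ENNReal.ofReal (∫ x in Ω, vectorDiv φ x)

/-- `g` is a smooth defining function of `Ω` in the open set `U`: inside `U`, the interior of `Ω` is
`{g < 0}`, the boundary of `Ω` is `{g = 0}`, and `∇g` does not vanish on the boundary. -/
structure IsDefiningFunction {n : ℕ} (Ω U : Set (EuclideanSpace ℝ (Fin n)))
    (g : EuclideanSpace ℝ (Fin n) → ℝ) : Prop where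
  isOpen : IsOpen U
  smooth : ContDiffOn ℝ ∞ g U
  interior_iff : ∀ y ∈ U, y ∈ interior Ω ↔ g y < 0
  frontier_iff : ∀ y ∈ U, y ∈ frontier Ω ↔ g y = 0
  gradient_ne_zero : ∀ y ∈ U, y ∈ frontier Ω → ∇ g y ≠ 0

/-- `∂Ω` is a smooth (`C^∞`) hypersurface. -/
def HasSmoothBoundary {n : ℕ} (Ω : Set (EuclideanSpace ℝ (Fin n))) : Prop :=
  ∀ x ∈ frontier Ω, ∃ U g, x ∈ U ∧ IsDefiningFunction Ω U g

/-- `h` is the mean curvature of `∂Ω` at `x` (the sum of the principal curvatures, positive where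
`Ω` is strictly convex): `h = div (∇g / |∇g|)` at `x` for a smooth local defining function `g`. The
value does not depend on `g`. -/
def HasMeanCurvatureAt {n : ℕ} (Ω : Set (EuclideanSpace ℝ (Fin n)))
    (x : EuclideanSpace ℝ (Fin n)) (h : ℝ) : Prop :=
  ∃ U g, x ∈ U ∧ IsDefiningFunction Ω U g ∧ h = vectorDiv (fun y => ‖∇ g y‖⁻¹ • ∇ g y) x

/-- The mean curvature `H(x)` of `∂Ω` at `x ∈ ∂Ω` (meaningful where `∂Ω` is smooth near `x`). -/
noncomputable def meanCurvature {n : ℕ} (Ω : Set (EuclideanSpace ℝ (Fin n)))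
    (x : EuclideanSpace ℝ (Fin n)) : ℝ :=
  Classical.epsilon (HasMeanCurvatureAt Ω x)

/-- The total squared mean curvature `∫_{∂Ω} H² dσ`, where the surface measure `σ` is the
`(n-1)`-dimensional Hausdorff measure, normalized as Lebesgue measure on hyperplanes. -/
noncomputable def curvatureEnergy {n : ℕ} (Ω : Set (EuclideanSpace ℝ (Fin n))) : ℝ≥0∞ :=
  ∫⁻ x in frontier Ω, ENNReal.ofReal (meanCurvature Ω x ^ 2) ∂μHE[n - 1]

/-!
The bound is in fact linear in the Hausdorff distance, and it comes from a calibration. Let `g` be the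
gauge (Minkowski functional) of `Ω = Ω¹_t`. Star-shapedness with respect to `B_r` makes `g` Lipschitz
(`gauge_add_le_of_mem_starClass`), and by the implicit function theorem `g` is smooth away from the
origin (`contDiffAt_gauge`). The field `X = ∇g / |∇g|` extends the outward unit normal of `Ω` and is
constant along rays, so `div X` equals `H` on `∂Ω` and is homogeneous of degree `-1`.

Cut off near `0` and near infinity, `X` is a test field for the perimeter. It is optimal for `Ω`
(`perimeter_le_setIntegral_vectorDiv`, which needs only an integration by parts against functions of
`g`, and no surface integrals) and admissible for `Ω' = Ω²_t`. Therefore `Per Ω - Per Ω'` is at most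
the integral of `|div X|` over the symmetric difference of `Ω` and `Ω'`
(`perimeter_le_perimeter_add`). If the Hausdorff distance is less than `δ r`, the symmetric difference
lies in the shell `(1 + δ)⁻¹ ≤ g ≤ 1 + δ` (`mem_gaugeShell_of_mem_symmDiff`). The radial projection
onto `∂Ω` maps the volume of the shell to a measure that is at most `O(δ)` times the
`(n - 1)`-dimensional Hausdorff measure (`map_radialProj_le_hausdorffMeasure`, by a covering argument),
so with `|H| ≤ 1 + H²` the integral is at most `C δ (1 + ∫ H² dσ)`
(`exists_lintegral_vectorDiv_shell_le`). Integrating in time, exchanging the two families and letting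
`δ r` decrease to `D = sup d_H` gives `|∫ (Per Ω¹ - Per Ω²) dt| ≤ C (T + W) D / r`, and the square is
estimated with `D ≤ R`.

The mean curvature of the statement is computed from an arbitrary defining function; that `g - 1` gives
the same value is `vectorDiv_unitGradient_eq_of_isDefiningFunction`. Finiteness and integrability of
the perimeters follow from the uniform bound `exists_perimeter_le`.
-/

/-! ### The gauge of a set that is star-shaped with respect to a ball -/

section GaugeOfStarShaped

open scoped Pointwise

variable {n : ℕ} {r R : ℝ} {Ω : Set (EuclideanSpace ℝ (Fin n))}

lemma ball_subset_of_mem_starClass (hΩ : Ω ∈ starClass n r R) : Metric.ball 0 r ⊆ Ω :=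
  fun y hy => (hΩ.1.2 y hy).1

lemma starConvex_zero_of_mem_starClass (hr : 0 < r) (hΩ : Ω ∈ starClass n r R) :
    StarConvex ℝ 0 Ω :=
  (hΩ.1.2 0 (Metric.mem_ball_self hr)).2

lemma absorbent_of_mem_starClass (hr : 0 < r) (hΩ : Ω ∈ starClass n r R) : Absorbent ℝ Ω :=
  absorbent_nhds_zero (Filter.mem_of_superset (Metric.ball_mem_nhds 0 hr)
    (ball_subset_of_mem_starClass hΩ))

/-- Enlarging a star-shaped set by a distance less than `δ * r` stays inside the dilation by the
factor `1 + δ`: the segments to the points of `B_r` fill a cone of definite opening. -/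
lemma mem_dilation_of_dist_lt (hΩ : Ω ∈ starClass n r R) {δ : ℝ} (hδ : 0 < δ)
    {y z : EuclideanSpace ℝ (Fin n)} (hz : z ∈ Ω) (hyz : dist y z < δ * r) :
    y ∈ (1 + δ) • Ω := by
  set w : EuclideanSpace ℝ (Fin n) := δ⁻¹ • (y - z) with hw
  have hwb : w ∈ Metric.ball (0 : EuclideanSpace ℝ (Fin n)) r := by
    rw [mem_ball_zero_iff, hw, norm_smul, norm_inv, Real.norm_of_nonneg hδ.le, ← dist_eq_norm,
      inv_mul_lt_iff₀ hδ]
    exact hyz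
  have h1 : (0 : ℝ) < 1 + δ := by linarith
  rw [mem_smul_set_iff_inv_smul_mem₀ h1.ne']
  have : (δ / (1 + δ)) • w + (1 / (1 + δ)) • z ∈ Ω :=
    (hΩ.1.2 w hwb).2 hz (by positivity) (by positivity) (by field_simp; ring)
  convert this using 1
  rw [hw, smul_smul, smul_sub, show δ / (1 + δ) * δ⁻¹ = (1 + δ)⁻¹ by field_simp, one_div]
  abel

lemma mem_smul_of_gauge_lt (hr : 0 < r) (hΩ : Ω ∈ starClass n r R) {a : ℝ}
    {x : EuclideanSpace ℝ (Fin n)} (h : gauge Ω x < a) : x ∈ a • Ω := by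
  obtain ⟨b, hb, hba, hx⟩ := exists_lt_of_gauge_lt (absorbent_of_mem_starClass hr hΩ) h
  have ha : 0 < a := hb.trans hba
  rw [mem_smul_set_iff_inv_smul_mem₀ hb.ne'] at hx
  rw [mem_smul_set_iff_inv_smul_mem₀ ha.ne']
  have := (starConvex_zero_of_mem_starClass hr hΩ).smul_mem hx (t := b / a) (by positivity)
    ((div_le_one ha).2 hba.le)
  rwa [smul_smul, show b / a * b⁻¹ = a⁻¹ by field_simp] at this

/-- The gauge of a set that is star-shaped with respect to `B_r` is `1 / r`-Lipschitz, although the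
set need not be convex. -/
lemma gauge_add_le_of_mem_starClass (hr : 0 < r) (hΩ : Ω ∈ starClass n r R)
    (x v : EuclideanSpace ℝ (Fin n)) : gauge Ω (x + v) ≤ gauge Ω x + ‖v‖ / r := by
  refine le_of_forall_pos_le_add fun ε hε => ?_
  set a := gauge Ω x + ε / 2 with ha
  set b := ‖v‖ / r + ε / 2 with hb
  have ha0 : 0 < a := by have := gauge_nonneg (s := Ω) x; positivity
  have hb0 : 0 < b := by positivity
  have hx : x ∈ a • Ω := mem_smul_of_gauge_lt hr hΩ (by linarith)
  rw [mem_smul_set_iff_inv_smul_mem₀ ha0.ne'] at hx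
  have := mem_dilation_of_dist_lt hΩ (δ := b / a) (by positivity)
    (y := a⁻¹ • (x + v)) hx (by
      rw [dist_eq_norm, ← smul_sub, add_sub_cancel_left, norm_smul, norm_inv,
        Real.norm_of_nonneg ha0.le]
      have : ‖v‖ < b * r := by rw [hb, add_mul, div_mul_cancel₀ _ hr.ne']; linarith [mul_pos hε hr]
      calc a⁻¹ * ‖v‖ < a⁻¹ * (b * r) := by gcongr
        _ = b / a * r := by ring)
  have h2 : x + v ∈ (a + b) • Ω := by
    rw [mem_smul_set_iff_inv_smul_mem₀ (by positivity)] at this ⊢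
    rwa [smul_smul, ← mul_inv, show (1 + b / a) * a = a + b by field_simp] at this
  have := gauge_le_of_mem (by positivity) h2
  linarith

lemma norm_gauge_sub_le (hr : 0 < r) (hΩ : Ω ∈ starClass n r R)
    (x y : EuclideanSpace ℝ (Fin n)) : ‖gauge Ω x - gauge Ω y‖ ≤ 1 / r * ‖x - y‖ := by
  have h1 := gauge_add_le_of_mem_starClass hr hΩ y (x - y)
  have h2 := gauge_add_le_of_mem_starClass hr hΩ x (y - x)
  rw [add_sub_cancel] at h1 h2
  rw [norm_sub_rev y x] at h2
  rw [Real.norm_eq_abs, abs_le, one_div, inv_mul_eq_div]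
  constructor <;> linarith

lemma continuous_gauge_of_mem_starClass (hr : 0 < r) (hΩ : Ω ∈ starClass n r R) :
    Continuous (gauge Ω) := by
  refine (LipschitzWith.of_dist_le_mul (K := ⟨1 / r, by positivity⟩) fun x y => ?_).continuous
  rw [dist_eq_norm, dist_eq_norm]
  exact norm_gauge_sub_le hr hΩ x y

lemma norm_le_mul_gauge (hr : 0 < r) (hR : 0 < R) (hΩ : Ω ∈ starClass n r R)
    (x : EuclideanSpace ℝ (Fin n)) : ‖x‖ ≤ R * gauge Ω x := by
  refine le_of_forall_pos_le_add fun ε hε => ?_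
  have ha : 0 < gauge Ω x + ε / R := by have := gauge_nonneg (s := Ω) x; positivity
  have hx := mem_smul_of_gauge_lt hr hΩ (x := x) (a := gauge Ω x + ε / R)
    (by have : 0 < ε / R := by positivity
        linarith)
  rw [mem_smul_set_iff_inv_smul_mem₀ ha.ne'] at hx
  have := hΩ.2 hx
  rw [mem_ball_zero_iff, norm_smul, norm_inv, Real.norm_of_nonneg ha.le, inv_mul_lt_iff₀ ha] at this
  have e : (gauge Ω x + ε / R) * R = R * gauge Ω x + ε := by field_simp
  linarith

lemma mul_gauge_le_norm_of_mem_starClass (hr : 0 < r) (hΩ : Ω ∈ starClass n r R)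
    (x : EuclideanSpace ℝ (Fin n)) : r * gauge Ω x ≤ ‖x‖ := by
  have := gauge_add_le_of_mem_starClass hr hΩ 0 x
  rw [zero_add, gauge_zero, zero_add, le_div_iff₀ hr] at this
  linarith

lemma gauge_pos_of_mem_starClass (hr : 0 < r) (hR : 0 < R) (hΩ : Ω ∈ starClass n r R)
    {x : EuclideanSpace ℝ (Fin n)} (hx : x ≠ 0) : 0 < gauge Ω x := by
  have := norm_le_mul_gauge hr hR hΩ x
  have h2 := norm_pos_iff.2 hx
  by_contra! h
  have := mul_nonpos_of_nonneg_of_nonpos hR.le h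
  linarith

lemma gauge_smul_nonneg {s : ℝ} (hs : 0 ≤ s) (x : EuclideanSpace ℝ (Fin n)) :
    gauge Ω (s • x) = s * gauge Ω x := by
  rw [gauge_smul_of_nonneg hs, smul_eq_mul]

lemma interior_eq_gauge_lt_one (hr : 0 < r) (hΩ : Ω ∈ starClass n r R) :
    interior Ω = {x | gauge Ω x < 1} := by
  refine (interior_subset_gauge_lt_one Ω).antisymm (interior_maximal (fun x hx => ?_) ?_)
  · simpa using mem_smul_of_gauge_lt hr hΩ hx
  · exact isOpen_lt (continuous_gauge_of_mem_starClass hr hΩ) continuous_const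

lemma closure_eq_gauge_le_one (hr : 0 < r) (hΩ : Ω ∈ starClass n r R) :
    closure Ω = {x | gauge Ω x ≤ 1} := by
  refine (closure_minimal (fun x hx => gauge_le_one_of_mem hx)
    (isClosed_le (continuous_gauge_of_mem_starClass hr hΩ) continuous_const)).antisymm
    fun x hx => ?_
  have ht : Filter.Tendsto (fun s : ℝ => s • x) (𝓝[<] 1) (𝓝 x) := by
    have : Filter.Tendsto (fun s : ℝ => s • x) (𝓝 1) (𝓝 ((1 : ℝ) • x)) :=
      (continuous_id.smul continuous_const).tendsto 1
    rw [one_smul] at this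
    exact this.mono_left nhdsWithin_le_nhds
  refine mem_closure_of_tendsto ht ?_
  filter_upwards [Ioo_mem_nhdsLT (show (0 : ℝ) < 1 by norm_num)] with s hs
  refine interior_subset ?_
  rw [interior_eq_gauge_lt_one hr hΩ, mem_ofPred_eq, gauge_smul_nonneg hs.1.le]
  have : gauge Ω x ≤ 1 := hx
  nlinarith [hs.1, hs.2]

lemma frontier_eq_gauge_eq_one (hr : 0 < r) (hΩ : Ω ∈ starClass n r R) :
    frontier Ω = {x | gauge Ω x = 1} := by
  rw [frontier, closure_eq_gauge_le_one hr hΩ, interior_eq_gauge_lt_one hr hΩ]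
  ext x
  simp only [mem_sdiff, mem_ofPred_eq, not_lt]
  exact ⟨fun h => le_antisymm h.1 h.2, fun h => ⟨h.le, h.ge⟩⟩

lemma setOf_gauge_lt_eq_smul {s : ℝ} (hs : 0 < s) :
    {x | gauge Ω x < s} = s • {x : EuclideanSpace ℝ (Fin n) | gauge Ω x < 1} := by
  ext x
  rw [mem_smul_set_iff_inv_smul_mem₀ hs.ne', mem_ofPred_eq, mem_ofPred_eq,
    gauge_smul_nonneg (by positivity), inv_mul_lt_iff₀ hs, mul_one]

lemma volume_gauge_lt {s : ℝ} (hs : 0 < s) :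
    volume {x | gauge Ω x < s} =
      ENNReal.ofReal (s ^ n) * volume {x : EuclideanSpace ℝ (Fin n) | gauge Ω x < 1} := by
  rw [setOf_gauge_lt_eq_smul hs, Measure.addHaar_smul, abs_of_nonneg (by positivity),
    finrank_euclideanSpace_fin]

lemma volume_gauge_lt_one_le (hr : 0 < r) (hΩ : Ω ∈ starClass n r R) :
    volume {x : EuclideanSpace ℝ (Fin n) | gauge Ω x < 1} ≤
      volume (Metric.ball (0 : EuclideanSpace ℝ (Fin n)) R) := by
  rw [← interior_eq_gauge_lt_one hr hΩ]
  exact measure_mono (interior_subset.trans hΩ.2)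

/-- The shell `{a ≤ g < b}` of the gauge has volume at most `n b ^ (n - 1) (b - a) |B_R|`. -/
lemma volume_gauge_shell_le (hr : 0 < r) (hΩ : Ω ∈ starClass n r R) {a b : ℝ} (ha : 0 < a)
    (hab : a ≤ b) :
    volume {x | a ≤ gauge Ω x ∧ gauge Ω x < b} ≤
      ENNReal.ofReal (n * b ^ (n - 1) * (b - a)) *
        volume (Metric.ball (0 : EuclideanSpace ℝ (Fin n)) R) := by
  set V := volume {x : EuclideanSpace ℝ (Fin n) | gauge Ω x < 1} with hV
  have hVle := volume_gauge_lt_one_le hr hΩ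
  have hVtop : V ≠ ⊤ := (hVle.trans_lt measure_ball_lt_top).ne
  have hb : 0 < b := ha.trans_le hab
  have hset : {x | a ≤ gauge Ω x ∧ gauge Ω x < b} =
      {x | gauge Ω x < b} \ {x | gauge Ω x < a} := by
    ext x; simp [and_comm]
  have hmeas : MeasurableSet {x | gauge Ω x < a} :=
    (isOpen_lt (continuous_gauge_of_mem_starClass hr hΩ) continuous_const).measurableSet
  have hsub : {x | gauge Ω x < a} ⊆ {x | gauge Ω x < b} := fun x hx => lt_of_lt_of_le hx hab
  rw [hset, measure_sdiff hsub
    hmeas.nullMeasurableSet (by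
      rw [volume_gauge_lt ha]; exact ENNReal.mul_ne_top ENNReal.ofReal_ne_top hVtop),
    volume_gauge_lt ha, volume_gauge_lt hb, ← ENNReal.sub_mul (fun _ _ => hVtop),
    ← ENNReal.ofReal_sub _ (by positivity)]
  refine mul_le_mul' (ENNReal.ofReal_le_ofReal ?_) hVle
  have := (le_abs_self _).trans (abs_pow_sub_pow_le b a n)
  rw [abs_of_pos hb, abs_of_pos ha, max_eq_left hab, abs_of_nonneg (sub_nonneg.2 hab)] at this
  linarith

lemma volume_frontier_eq_zero (hr : 0 < r) (hΩ : Ω ∈ starClass n r R) :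
    volume (frontier Ω) = 0 := by
  rw [frontier_eq_gauge_eq_one hr hΩ]
  have hle : ∀ ε ∈ Ioi (0 : ℝ), volume {x | gauge Ω x = 1} ≤
      ENNReal.ofReal (n * (1 + ε) ^ (n - 1) * ε) *
        volume (Metric.ball (0 : EuclideanSpace ℝ (Fin n)) R) := by
    intro ε hε
    have hε' : (0 : ℝ) < ε := hε
    refine (measure_mono fun x hx => ?_).trans ((volume_gauge_shell_le hr hΩ (a := 1) (b := 1 + ε)
      one_pos (by linarith)).trans_eq (by rw [add_sub_cancel_left]))
    have hx' : gauge Ω x = 1 := hx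
    exact ⟨hx'.ge, by rw [hx']; linarith⟩
  have ht : Filter.Tendsto (fun ε : ℝ => ENNReal.ofReal (n * (1 + ε) ^ (n - 1) * ε) *
      volume (Metric.ball (0 : EuclideanSpace ℝ (Fin n)) R)) (𝓝[>] 0) (𝓝 0) := by
    have h0 : Filter.Tendsto (fun ε : ℝ => (n * (1 + ε) ^ (n - 1) * ε : ℝ)) (𝓝 0) (𝓝 0) :=
      Continuous.tendsto' (by fun_prop) _ _ (by simp)
    have h1 := ENNReal.tendsto_ofReal (h0.mono_left (nhdsWithin_le_nhds (s := Ioi 0)))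
    simpa using ENNReal.Tendsto.mul_const h1 (Or.inr measure_ball_lt_top.ne)
  exact le_antisymm (ge_of_tendsto ht (eventually_mem_nhdsWithin.mono hle)) bot_le

lemma ae_eq_interior (hr : 0 < r) (hΩ : Ω ∈ starClass n r R) :
    Ω =ᵐ[volume] {x | gauge Ω x < 1} := by
  rw [← interior_eq_gauge_lt_one hr hΩ]
  exact (interior_ae_eq_of_null_frontier (volume_frontier_eq_zero hr hΩ)).symm

end GaugeOfStarShaped

/-! ### Unit normal fields and independence of the mean curvature of the defining function -/

section UnitGradient

variable {n : ℕ}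

/-- The normalized gradient `∇g / |∇g|`: on the zero set of a defining function `g` it is the outward
unit normal. It is `0` where `∇g` vanishes. -/
noncomputable def unitGradient (g : EuclideanSpace ℝ (Fin n) → ℝ)
    (x : EuclideanSpace ℝ (Fin n)) : EuclideanSpace ℝ (Fin n) :=
  ‖∇ g x‖⁻¹ • ∇ g x

variable {g : EuclideanSpace ℝ (Fin n) → ℝ} {x : EuclideanSpace ℝ (Fin n)}

lemma norm_unitGradient (h : ∇ g x ≠ 0) : ‖unitGradient g x‖ = 1 := by
  rw [unitGradient, norm_smul, norm_inv, norm_norm, inv_mul_cancel₀ (norm_ne_zero_iff.2 h)]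

lemma contDiffAt_gradient (h : ContDiffAt ℝ ∞ g x) : ContDiffAt ℝ ∞ (∇ g) x :=
  (InnerProductSpace.toDual ℝ (EuclideanSpace ℝ (Fin n))).symm.contDiff.contDiffAt.comp x
    (h.fderiv_right (m := ∞) (by simp))

lemma contDiffAt_unitGradient (h : ContDiffAt ℝ ∞ g x) (h0 : ∇ g x ≠ 0) :
    ContDiffAt ℝ ∞ (unitGradient g) x :=
  (((contDiffAt_gradient h).norm ℝ h0).inv (norm_ne_zero_iff.2 h0)).smul (contDiffAt_gradient h)

/-- A function that is constant on a regular level set of `f` has derivative proportional to that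
of `f`. -/
lemma exists_fderiv_eq_smul_of_const_on_level {f φ : EuclideanSpace ℝ (Fin n) → ℝ}
    {f' φ' : StrongDual ℝ (EuclideanSpace ℝ (Fin n))} (hf : HasStrictFDerivAt f f' x)
    (hφ : HasStrictFDerivAt φ φ' x) (hf' : f' ≠ 0)
    (h : ∀ᶠ y in 𝓝 x, f y = f x → φ y = φ x) : ∃ c : ℝ, φ' = c • f' := by
  have hext : IsLocalExtrOn φ {y | f y = f x} x := by
    refine Or.inl ?_
    change ∀ᶠ y in 𝓝[{y | f y = f x}] x, φ x ≤ φ y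
    rw [eventually_nhdsWithin_iff]
    filter_upwards [h] with y hy hy' using (hy hy').ge
  obtain ⟨a, b, hab, h0⟩ := hext.exists_multipliers_of_hasStrictFDerivAt_1d hf hφ
  have hb : b ≠ 0 := by
    rintro rfl
    have ha : a ≠ 0 := fun ha => hab (by rw [ha]; rfl)
    rw [zero_smul, add_zero, smul_eq_zero] at h0
    exact h0.elim ha hf'
  refine ⟨-(b⁻¹ * a), ?_⟩
  ext v
  have hv : a * f' v + b * φ' v = 0 := congrArg (fun L => L v) h0
  change φ' v = -(b⁻¹ * a) * f' v
  field_simp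
  linarith

lemma fderiv_nonpos_of_eventually_le {f : EuclideanSpace ℝ (Fin n) → ℝ}
    {v : EuclideanSpace ℝ (Fin n)} (hf : DifferentiableAt ℝ f x)
    (h : ∀ᶠ s : ℝ in 𝓝[>] 0, f (x + s • v) ≤ f x) : fderiv ℝ f x v ≤ 0 := by
  refine le_of_tendsto (hf.hasFDerivAt.hasLineDerivAt v).tendsto_slope_zero_right ?_
  filter_upwards [h, self_mem_nhdsWithin] with s hs hs0
  have hs0' : (0 : ℝ) < s := hs0
  exact mul_nonpos_of_nonneg_of_nonpos (by positivity) (by linarith)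

lemma fderiv_ne_zero_of_gradient_ne_zero (h : ∇ g x ≠ 0) : fderiv ℝ g x ≠ 0 := by
  intro h0
  exact h (by rw [gradient, h0, map_zero])

end UnitGradient

section MeanCurvature

variable {n : ℕ} {Ω U V : Set (EuclideanSpace ℝ (Fin n))}
  {f g : EuclideanSpace ℝ (Fin n) → ℝ} {x : EuclideanSpace ℝ (Fin n)}

lemma IsDefiningFunction.contDiffAt (hg : IsDefiningFunction Ω U g) (hx : x ∈ U) :
    ContDiffAt ℝ ∞ g x :=
  hg.smooth.contDiffAt (hg.isOpen.mem_nhds hx)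

/-- Two defining functions of the same set have positively proportional gradients on the boundary,
hence the same normalized gradient there. -/
lemma unitGradient_eq_of_isDefiningFunction (hf : IsDefiningFunction Ω U f)
    (hg : IsDefiningFunction Ω V g) (hxU : x ∈ U) (hxV : x ∈ V) (hx : x ∈ frontier Ω) :
    unitGradient f x = unitGradient g x := by
  have hfs := (hf.contDiffAt hxU).hasStrictFDerivAt (by simp)
  have hgs := (hg.contDiffAt hxV).hasStrictFDerivAt (by simp)
  have hf0 := hf.gradient_ne_zero x hxU hx
  have hg0 := hg.gradient_ne_zero x hxV hx
  have hfx := (hf.frontier_iff x hxU).1 hx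
  have hgx := (hg.frontier_iff x hxV).1 hx
  have hUV : ∀ᶠ y in 𝓝 x, y ∈ U ∧ y ∈ V :=
    Filter.Eventually.and (hf.isOpen.mem_nhds hxU) (hg.isOpen.mem_nhds hxV)
  obtain ⟨c, hc⟩ := exists_fderiv_eq_smul_of_const_on_level hfs hgs
    (fderiv_ne_zero_of_gradient_ne_zero hf0) (by
      filter_upwards [hUV] with y hy hfy
      rw [hgx]
      rw [hfx] at hfy
      exact (hg.frontier_iff y hy.2).1 ((hf.frontier_iff y hy.1).2 hfy))
  have hgrad : ∇ g x = c • ∇ f x := by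
    rw [gradient, gradient, hc, map_smulₛₗ]; rfl
  have hc0 : c ≠ 0 := by
    rintro rfl
    rw [zero_smul] at hgrad
    exact hg0 hgrad
  -- In the direction `-∇f` both functions become negative, so the factor is positive.
  have hcpos : 0 ≤ c := by
    have hneg : ∀ᶠ s : ℝ in 𝓝[>] 0, f (x + s • (-∇ f x)) < 0 := by
      have hlt : fderiv ℝ f x (-∇ f x) < 0 := by
        rw [map_neg, ← inner_gradient_left, real_inner_self_eq_norm_sq, neg_lt_zero]
        have := norm_pos_iff.2 hf0
        positivity
      have := (hfs.hasFDerivAt.hasLineDerivAt (-∇ f x)).tendsto_slope_zero_right.eventually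
        (gt_mem_nhds hlt)
      filter_upwards [this, self_mem_nhdsWithin] with s hs hs0
      have hs0' : (0 : ℝ) < s := hs0
      rw [hfx, sub_zero, smul_eq_mul, inv_mul_lt_iff₀ hs0', mul_zero] at hs
      exact hs
    have hline : Filter.Tendsto (fun s : ℝ => x + s • (-∇ f x)) (𝓝[>] 0) (𝓝 x) := by
      have : Filter.Tendsto (fun s : ℝ => x + s • (-∇ f x)) (𝓝 0) (𝓝 x) :=
        Continuous.tendsto' (by fun_prop) _ _ (by simp)
      exact this.mono_left nhdsWithin_le_nhds
    have hle : fderiv ℝ g x (-∇ f x) ≤ 0 := by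
      refine fderiv_nonpos_of_eventually_le hgs.hasFDerivAt.differentiableAt ?_
      filter_upwards [hneg, hline.eventually hUV] with s hs hy
      rw [hgx]
      exact ((hg.interior_iff _ hy.2).1 ((hf.interior_iff _ hy.1).2 hs)).le
    rw [hc, map_neg, smul_apply, ← inner_gradient_left,
      real_inner_self_eq_norm_sq, smul_eq_mul, neg_nonpos] at hle
    have := norm_pos_iff.2 hf0
    exact nonneg_of_mul_nonneg_left hle (by positivity)
  have hcp : 0 < c := lt_of_le_of_ne hcpos hc0.symm
  rw [unitGradient, unitGradient, hgrad, norm_smul, Real.norm_of_nonneg hcpos, smul_smul]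
  congr 1
  field_simp

/-- The derivative of a field of unit vectors is orthogonal to the field. -/
lemma inner_fderiv_eq_zero_of_norm_eq_one
    {N : EuclideanSpace ℝ (Fin n) → EuclideanSpace ℝ (Fin n)} (hN : DifferentiableAt ℝ N x)
    (h1 : ∀ᶠ y in 𝓝 x, ‖N y‖ = 1) (v : EuclideanSpace ℝ (Fin n)) :
    inner ℝ (N x) (fderiv ℝ N x v) = 0 := by
  have h2 : HasFDerivAt (fun y => inner ℝ (N y) (N y))
      (0 : EuclideanSpace ℝ (Fin n) →L[ℝ] ℝ) x := by
    refine (hasFDerivAt_const (1 : ℝ) x).congr_of_eventuallyEq ?_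
    filter_upwards [h1] with y hy
    rw [real_inner_self_eq_norm_sq, hy, one_pow]
  have h3 := hN.hasFDerivAt.inner ℝ hN.hasFDerivAt
  have := congrArg (fun L : EuclideanSpace ℝ (Fin n) →L[ℝ] ℝ => L v) (h3.unique h2)
  simp only [ContinuousLinearMap.comp_apply, ContinuousLinearMap.prod_apply,
    fderivInnerCLM_apply, zero_apply] at this
  rw [real_inner_comm (N x)] at this
  rw [← real_inner_comm] at this ⊢
  linarith

/-- The mean curvature does not depend on the defining function: the difference of the two unit
normal fields vanishes along the boundary, so its derivative has the form `v ↦ ⟪∇f, v⟫ u`, and `u` is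
orthogonal to `∇f` because both fields have length one; hence its trace is zero. -/
lemma vectorDiv_unitGradient_eq_of_isDefiningFunction (hf : IsDefiningFunction Ω U f)
    (hg : IsDefiningFunction Ω V g) (hxU : x ∈ U) (hxV : x ∈ V) (hx : x ∈ frontier Ω) :
    vectorDiv (unitGradient f) x = vectorDiv (unitGradient g) x := by
  have hfs := (hf.contDiffAt hxU).hasStrictFDerivAt (by simp)
  have hf0 := hf.gradient_ne_zero x hxU hx
  have hg0 := hg.gradient_ne_zero x hxV hx
  have hfx := (hf.frontier_iff x hxU).1 hx
  have hNf := contDiffAt_unitGradient (hf.contDiffAt hxU) hf0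
  have hNg := contDiffAt_unitGradient (hg.contDiffAt hxV) hg0
  have hNfd := hNf.differentiableAt (by simp)
  have hNgd := hNg.differentiableAt (by simp)
  have hxeq := unitGradient_eq_of_isDefiningFunction hf hg hxU hxV hx
  set p := ∇ f x with hp
  set D := fderiv ℝ (unitGradient f) x - fderiv ℝ (unitGradient g) x with hD
  have hcomp : ∀ i, ∃ c : ℝ, ∀ v, D v i = c * inner ℝ p v := by
    intro i
    have hφ : HasStrictFDerivAt (fun y => (unitGradient f y - unitGradient g y) i)
        ((EuclideanSpace.proj i : StrongDual ℝ (EuclideanSpace ℝ (Fin n))) ∘L D) x :=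
      (EuclideanSpace.proj i : StrongDual ℝ (EuclideanSpace ℝ (Fin n))).hasStrictFDerivAt.comp x
        ((hNf.hasStrictFDerivAt (by simp)).sub (hNg.hasStrictFDerivAt (by simp)))
    obtain ⟨c, hc⟩ := exists_fderiv_eq_smul_of_const_on_level hfs hφ
      (fderiv_ne_zero_of_gradient_ne_zero hf0) (by
        filter_upwards [hf.isOpen.mem_nhds hxU, hg.isOpen.mem_nhds hxV] with y hyU hyV hfy
        rw [hfx] at hfy
        rw [unitGradient_eq_of_isDefiningFunction hf hg hyU hyV ((hf.frontier_iff y hyU).2 hfy),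
          hxeq, sub_self, sub_self])
    refine ⟨c, fun v => ?_⟩
    have := congrArg (fun L : StrongDual ℝ (EuclideanSpace ℝ (Fin n)) => L v) hc
    simpa [hp, inner_gradient_left] using this
  choose c hc using hcomp
  have hunit : ∀ {h : EuclideanSpace ℝ (Fin n) → ℝ}, ContDiffAt ℝ ∞ h x → ∇ h x ≠ 0 →
      ∀ᶠ y in 𝓝 x, ‖unitGradient h y‖ = 1 := by
    intro h hh h0
    filter_upwards [(contDiffAt_gradient hh).continuousAt.eventually_ne h0] with y hy
      using norm_unitGradient hy
  have hort : inner ℝ (unitGradient f x) (D p) = 0 := by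
    rw [hD, sub_apply, inner_sub_right,
      inner_fderiv_eq_zero_of_norm_eq_one hNfd (hunit (hf.contDiffAt hxU) hf0), hxeq,
      inner_fderiv_eq_zero_of_norm_eq_one hNgd (hunit (hg.contDiffAt hxV) hg0), sub_zero]
  have hpp : 0 < ‖p‖ := norm_pos_iff.2 hf0
  have hsum : ∑ i, c i * p i = 0 := by
    rw [unitGradient, real_inner_smul_left, ← hp, PiLp.inner_apply] at hort
    simp only [hc, real_inner_self_eq_norm_sq, RCLike.inner_apply, conj_trivial] at hort
    have h2 : ∑ i, c i * ‖p‖ ^ 2 * p i = ‖p‖ ^ 2 * ∑ i, c i * p i := by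
      rw [Finset.mul_sum]
      exact Finset.sum_congr rfl fun i _ => by ring
    rw [h2] at hort
    rcases mul_eq_zero.1 hort with h | h
    · exact absurd h (by positivity)
    · exact (mul_eq_zero.1 h).resolve_left (by positivity)
  rw [← sub_eq_zero, vectorDiv, vectorDiv, ← Finset.sum_sub_distrib, ← hsum]
  refine Finset.sum_congr rfl fun i _ => ?_
  have := hc i (EuclideanSpace.single i 1)
  rw [EuclideanSpace.inner_single_right, conj_trivial, one_mul] at this
  rw [← this, hD]
  rfl

lemma meanCurvature_eq_vectorDiv (hg : IsDefiningFunction Ω U g) (hxU : x ∈ U)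
    (hx : x ∈ frontier Ω) : meanCurvature Ω x = vectorDiv (unitGradient g) x := by
  have hex : ∃ h, HasMeanCurvatureAt Ω x h := ⟨_, U, g, hxU, hg, rfl⟩
  obtain ⟨V, f, hxV, hf, h⟩ := Classical.epsilon_spec hex
  rw [meanCurvature, h]
  exact vectorDiv_unitGradient_eq_of_isDefiningFunction hf hg hxV hxU hx

end MeanCurvature

/-! ### Smoothness of the gauge -/

section SmoothGauge

variable {n : ℕ} {r R : ℝ} {Ω U : Set (EuclideanSpace ℝ (Fin n))}
  {x : EuclideanSpace ℝ (Fin n)}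

/-- The position vector is transversal to the boundary: segments from `B_r` to a boundary point run
through the interior up to their endpoint. -/
lemma inner_gradient_pos (hr : 0 < r) (hΩ : Ω ∈ starClass n r R)
    {f : EuclideanSpace ℝ (Fin n) → ℝ} (hf : IsDefiningFunction Ω U f) (hxU : x ∈ U)
    (hx : x ∈ frontier Ω) : 0 < inner ℝ (∇ f x) x := by
  have hfd := (hf.contDiffAt hxU).differentiableAt (by simp)
  have hf0 := norm_pos_iff.2 (hf.gradient_ne_zero x hxU hx)
  have hfx := (hf.frontier_iff x hxU).1 hx
  set w : EuclideanSpace ℝ (Fin n) := (r / 2 * ‖∇ f x‖⁻¹) • ∇ f x with hw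
  have hwn : ‖w‖ = r / 2 := by
    rw [hw, norm_smul, Real.norm_of_nonneg (by positivity)]
    field_simp
  have hle : fderiv ℝ f x (w - x) ≤ 0 := by
    refine fderiv_nonpos_of_eventually_le hfd ?_
    have hline : Filter.Tendsto (fun s : ℝ => x + s • (w - x)) (𝓝[>] 0) (𝓝 x) := by
      have : Filter.Tendsto (fun s : ℝ => x + s • (w - x)) (𝓝 0) (𝓝 x) :=
        Continuous.tendsto' (by fun_prop) _ _ (by simp)
      exact this.mono_left nhdsWithin_le_nhds
    filter_upwards [hline.eventually (hf.isOpen.mem_nhds hxU),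
      Ioo_mem_nhdsGT (show (0 : ℝ) < 1 by norm_num)] with s hsU hs
    have hin : x + s • (w - x) ∈ interior Ω := by
      rw [interior_eq_gauge_lt_one hr hΩ, mem_ofPred_eq,
        show x + s • (w - x) = (1 - s) • x + s • w by module]
      rw [frontier_eq_gauge_eq_one hr hΩ, mem_ofPred_eq] at hx
      have h1 := gauge_add_le_of_mem_starClass hr hΩ ((1 - s) • x) (s • w)
      rw [gauge_smul_nonneg (by linarith [hs.2]), hx, norm_smul, Real.norm_of_nonneg hs.1.le, hwn,
        show s * (r / 2) / r = s / 2 by field_simp] at h1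
      linarith [hs.1]
    rw [hfx]
    exact ((hf.interior_iff _ hsU).1 hin).le
  rw [map_sub, ← inner_gradient_left, ← inner_gradient_left, hw, real_inner_smul_right,
    real_inner_self_eq_norm_sq] at hle
  have : 0 < r / 2 * ‖∇ f x‖⁻¹ * ‖∇ f x‖ ^ 2 := by positivity
  linarith

lemma smul_inv_gauge_mem_frontier (hr : 0 < r) (hR : 0 < R) (hΩ : Ω ∈ starClass n r R)
    (hx : x ≠ 0) : (gauge Ω x)⁻¹ • x ∈ frontier Ω := by
  have := gauge_pos_of_mem_starClass hr hR hΩ hx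
  rw [frontier_eq_gauge_eq_one hr hΩ, mem_ofPred_eq, gauge_smul_nonneg (by positivity),
    inv_mul_cancel₀ this.ne']

lemma ne_zero_of_mem_frontier (hr : 0 < r) (hΩ : Ω ∈ starClass n r R) (hx : x ∈ frontier Ω) :
    x ≠ 0 := by
  rintro rfl
  rw [frontier_eq_gauge_eq_one hr hΩ, mem_ofPred_eq, gauge_zero] at hx
  exact zero_ne_one hx

/-- By the implicit function theorem for `(y, s) ↦ f (s • y)`, the reciprocal of the gauge is smooth
near a smooth boundary point. -/
lemma contDiffAt_gauge_of_mem_frontier (hr : 0 < r) (hR : 0 < R) (hΩ : Ω ∈ starClass n r R)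
    (hs : HasSmoothBoundary Ω) (hx : x ∈ frontier Ω) : ContDiffAt ℝ ∞ (gauge Ω) x := by
  obtain ⟨U, f, hxU, hf⟩ := hs x hx
  have hx0 := ne_zero_of_mem_frontier hr hΩ hx
  have hgx : gauge Ω x = 1 := by
    rwa [frontier_eq_gauge_eq_one hr hΩ, mem_ofPred_eq] at hx
  set F : EuclideanSpace ℝ (Fin n) × ℝ → ℝ := fun p => f (p.2 • p.1) with hF
  have hfc := hf.contDiffAt hxU
  have hsm : ContDiffAt ℝ ∞ (fun p : EuclideanSpace ℝ (Fin n) × ℝ => p.2 • p.1) (x, 1) :=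
    contDiffAt_snd.smul contDiffAt_fst
  have hFc : ContDiffAt ℝ ∞ F (x, 1) :=
    ContDiffAt.comp (x, (1 : ℝ)) (g := f) (by simpa using hfc) hsm
  have hFd : ∀ t : ℝ, (fderiv ℝ F (x, 1) ∘L .inr ℝ (EuclideanSpace ℝ (Fin n)) ℝ) t =
      t * inner ℝ (∇ f x) x := by
    intro t
    have hfd : HasFDerivAt f (fderiv ℝ f x)
        ((fun p : EuclideanSpace ℝ (Fin n) × ℝ => p.2 • p.1) (x, 1)) := by
      simpa using (hfc.differentiableAt (by simp)).hasFDerivAt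
    have h2 := hfd.comp (x, (1 : ℝ)) ((hasFDerivAt_snd (𝕜 := ℝ) (p := (x, (1 : ℝ)))).smul
      (hasFDerivAt_fst (𝕜 := ℝ) (p := (x, (1 : ℝ)))))
    have h3 : fderiv ℝ F (x, 1) = _ := h2.fderiv
    rw [h3]
    simp [inner_gradient_left]
  have hpos := inner_gradient_pos hr hΩ hf hxU hx
  have hinv : (fderiv ℝ F (x, 1) ∘L .inr ℝ (EuclideanSpace ℝ (Fin n)) ℝ).IsInvertible :=
    ⟨.unitsEquivAut ℝ (.mk0 _ hpos.ne'), by ext; simp [hFd]⟩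
  set ψ := hFc.implicitFunction (by simp) hinv with hψ
  have hψc : ContDiffAt ℝ ∞ ψ x := hFc.contDiffAt_implicitFunction (by simp) hinv
  have hψx : ψ x = 1 := hFc.implicitFunction_apply_self (by simp) hinv
  have hcont : Filter.Tendsto (fun y => (y, (gauge Ω y)⁻¹)) (𝓝 x) (𝓝 (x, (1 : ℝ))) := by
    have hc : ContinuousAt (fun y => (gauge Ω y)⁻¹) x :=
      (continuous_gauge_of_mem_starClass hr hΩ).continuousAt.inv₀ (by rw [hgx]; exact one_ne_zero)
    have := Filter.Tendsto.prodMk_nhds (Filter.tendsto_id (x := 𝓝 x)) hc.tendsto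
    rwa [hgx, inv_one] at this
  have hUev : ∀ᶠ y in 𝓝 x, (gauge Ω y)⁻¹ • y ∈ U := by
    have h1 : Filter.Tendsto (fun y => (gauge Ω y)⁻¹ • y) (𝓝 x) (𝓝 x) := by
      have := hsm.continuousAt.tendsto.comp hcont
      rwa [one_smul] at this
    exact h1.eventually (hf.isOpen.mem_nhds hxU)
  have hF1 : F (x, 1) = 0 := by
    rw [hF]
    simpa using (hf.frontier_iff x hxU).1 hx
  have hEq : gauge Ω =ᶠ[𝓝 x] fun y => (ψ y)⁻¹ := by
    filter_upwards [hcont.eventually (hFc.eventually_apply_eq_iff_implicitFunction (by simp) hinv),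
      hUev, isOpen_ne.mem_nhds hx0] with y hy hyU hy0
    have h0 : f ((gauge Ω y)⁻¹ • y) = 0 :=
      (hf.frontier_iff _ hyU).1 (smul_inv_gauge_mem_frontier hr hR hΩ hy0)
    have : ψ y = (gauge Ω y)⁻¹ := hy.1 (by rw [hF1]; exact h0)
    rw [this, inv_inv]
  exact (hψc.inv (by rw [hψx]; exact one_ne_zero)).congr_of_eventuallyEq hEq

lemma contDiffAt_gauge (hr : 0 < r) (hR : 0 < R) (hΩ : Ω ∈ starClass n r R)
    (hs : HasSmoothBoundary Ω) (hx : x ≠ 0) : ContDiffAt ℝ ∞ (gauge Ω) x := by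
  have hg := gauge_pos_of_mem_starClass hr hR hΩ hx
  have h1 := contDiffAt_gauge_of_mem_frontier hr hR hΩ hs (smul_inv_gauge_mem_frontier hr hR hΩ hx)
  have h2 : ContDiffAt ℝ ∞ (fun y => gauge Ω x * gauge Ω ((gauge Ω x)⁻¹ • y)) x :=
    contDiffAt_const.mul (h1.comp x (contDiff_const_smul _).contDiffAt)
  convert h2 using 1
  ext y
  rw [gauge_smul_nonneg (by positivity), mul_inv_cancel_left₀ hg.ne']

/-- Euler's identity for the gauge. -/
lemma inner_gradient_gauge_self (hd : DifferentiableAt ℝ (gauge Ω) x) :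
    inner ℝ (∇ (gauge Ω) x) x = gauge Ω x := by
  rw [inner_gradient_left]
  have h1 := (hd.hasFDerivAt.hasLineDerivAt x).tendsto_slope_zero_right
  refine tendsto_nhds_unique h1 (tendsto_const_nhds.congr' ?_)
  filter_upwards [self_mem_nhdsWithin] with s hs
  have hs' : (0 : ℝ) < s := hs
  rw [show x + s • x = (1 + s) • x by module, gauge_smul_nonneg (by positivity), smul_eq_mul]
  field_simp
  ring

lemma gradient_gauge_ne_zero (hr : 0 < r) (hR : 0 < R) (hΩ : Ω ∈ starClass n r R)
    (hs : HasSmoothBoundary Ω) (hx : x ≠ 0) : ∇ (gauge Ω) x ≠ 0 := by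
  intro h
  have := inner_gradient_gauge_self ((contDiffAt_gauge hr hR hΩ hs hx).differentiableAt (by simp))
  rw [h, inner_zero_left] at this
  exact (gauge_pos_of_mem_starClass hr hR hΩ hx).ne this

lemma norm_gradient_gauge_le (hr : 0 < r) (hΩ : Ω ∈ starClass n r R) :
    ‖∇ (gauge Ω) x‖ ≤ 1 / r := by
  rw [gradient, LinearIsometryEquiv.norm_map]
  exact norm_fderiv_le_of_lip' ℝ (by positivity)
    (Filter.Eventually.of_forall fun y => norm_gauge_sub_le hr hΩ y x)

lemma gradient_gauge_smul {s : ℝ} (hs : 0 < s) :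
    ∇ (gauge Ω) (s • x) = ∇ (gauge Ω) x := by
  have h1 : (fun y => gauge Ω (s • y)) = s • gauge Ω := by
    ext y
    rw [gauge_smul_nonneg hs.le, Pi.smul_apply, smul_eq_mul]
  have h2 := fderiv_comp_smul (𝕜 := ℝ) (f := gauge Ω) (x := x) s
  rw [h1, fderiv_const_smul_field] at h2
  have h3 := smul_right_injective _ hs.ne' h2
  rw [gradient, gradient, ← h3]

lemma unitGradient_gauge_smul {s : ℝ} (hs : 0 < s) :
    unitGradient (gauge Ω) (s • x) = unitGradient (gauge Ω) x := by
  rw [unitGradient, unitGradient, gradient_gauge_smul hs]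

/-- The normalized gradient of the gauge is constant along rays, so its divergence is homogeneous of
degree `-1`. -/
lemma vectorDiv_unitGradient_gauge_smul {s : ℝ} (hs : 0 < s) :
    s * vectorDiv (unitGradient (gauge Ω)) (s • x) = vectorDiv (unitGradient (gauge Ω)) x := by
  have h1 : (fun y => unitGradient (gauge Ω) (s • y)) = unitGradient (gauge Ω) :=
    funext fun y => unitGradient_gauge_smul hs
  have h2 := fderiv_comp_smul (𝕜 := ℝ) (f := unitGradient (gauge Ω)) (x := x) s
  rw [h1] at h2
  rw [vectorDiv, vectorDiv, h2, Finset.mul_sum]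
  exact Finset.sum_congr rfl fun i _ => rfl

lemma isDefiningFunction_gauge_sub_one (hr : 0 < r) (hR : 0 < R) (hΩ : Ω ∈ starClass n r R)
    (hs : HasSmoothBoundary Ω) : IsDefiningFunction Ω {0}ᶜ (fun y => gauge Ω y - 1) where
  isOpen := isOpen_compl_singleton
  smooth := fun y hy =>
    ((contDiffAt_gauge hr hR hΩ hs hy).sub contDiffAt_const).contDiffWithinAt
  interior_iff := fun y _ => by
    rw [interior_eq_gauge_lt_one hr hΩ, mem_ofPred_eq, sub_neg]
  frontier_iff := fun y _ => by
    rw [frontier_eq_gauge_eq_one hr hΩ, mem_ofPred_eq, sub_eq_zero]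
  gradient_ne_zero := fun y hy _ => by
    rw [gradient, fderiv_sub_const]
    exact gradient_gauge_ne_zero hr hR hΩ hs hy

lemma meanCurvature_eq_vectorDiv_gauge (hr : 0 < r) (hR : 0 < R) (hΩ : Ω ∈ starClass n r R)
    (hs : HasSmoothBoundary Ω) (hx : x ∈ frontier Ω) :
    meanCurvature Ω x = vectorDiv (unitGradient (gauge Ω)) x := by
  rw [meanCurvature_eq_vectorDiv (isDefiningFunction_gauge_sub_one hr hR hΩ hs)
    (ne_zero_of_mem_frontier hr hΩ hx) hx]
  congr 1
  ext1 y
  rw [unitGradient, unitGradient, gradient, gradient, fderiv_sub_const]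

lemma continuousOn_vectorDiv_unitGradient_gauge (hr : 0 < r) (hR : 0 < R)
    (hΩ : Ω ∈ starClass n r R) (hs : HasSmoothBoundary Ω) :
    ContinuousOn (vectorDiv (unitGradient (gauge Ω))) {0}ᶜ := by
  intro y hy
  have h1 := contDiffAt_unitGradient (contDiffAt_gauge hr hR hΩ hs hy)
    (gradient_gauge_ne_zero hr hR hΩ hs hy)
  have h2 := (h1.fderiv_right (m := 0) (by simp)).continuousAt
  have h3 : ContinuousAt (vectorDiv (unitGradient (gauge Ω))) y := by
    unfold vectorDiv
    refine tendsto_finsetSum _ fun i _ => ?_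
    exact (EuclideanSpace.proj i : StrongDual ℝ (EuclideanSpace ℝ (Fin n))).continuous.continuousAt
      |>.tendsto.comp (h2.clm_apply continuousAt_const)
  exact h3.continuousWithinAt

end SmoothGauge

/-! ### Calibration bounds for the perimeter -/

section Divergence

variable {n : ℕ} {Y Z : EuclideanSpace ℝ (Fin n) → EuclideanSpace ℝ (Fin n)}
  {x : EuclideanSpace ℝ (Fin n)}

lemma continuous_vectorDiv (hY : ContDiff ℝ 1 Y) : Continuous (vectorDiv Y) := by
  unfold vectorDiv
  refine continuous_finsetSum _ fun i _ => ?_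
  exact (EuclideanSpace.proj i : StrongDual ℝ (EuclideanSpace ℝ (Fin n))).continuous.comp
    ((hY.continuous_fderiv one_ne_zero).clm_apply continuous_const)

lemma hasCompactSupport_vectorDiv (hY : HasCompactSupport Y) :
    HasCompactSupport (vectorDiv Y) := by
  refine (hY.fderiv ℝ).mono fun x hx => ?_
  contrapose! hx
  rw [Function.notMem_support] at hx ⊢
  simp [vectorDiv, hx]

lemma integrable_vectorDiv (hY : ContDiff ℝ 1 Y) (hYc : HasCompactSupport Y) :
    Integrable (vectorDiv Y) :=
  (continuous_vectorDiv hY).integrable_of_hasCompactSupport (hasCompactSupport_vectorDiv hYc)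

lemma vectorDiv_sub (hY : DifferentiableAt ℝ Y x) (hZ : DifferentiableAt ℝ Z x) :
    vectorDiv (Y - Z) x = vectorDiv Y x - vectorDiv Z x := by
  rw [vectorDiv, vectorDiv, vectorDiv, ← Finset.sum_sub_distrib, fderiv_sub hY hZ]
  rfl

lemma vectorDiv_congr (h : Y =ᶠ[𝓝 x] Z) : vectorDiv Y x = vectorDiv Z x := by
  rw [vectorDiv, vectorDiv, h.fderiv_eq]

/-- Integration by parts: `∫ χ div Y = -∫ ⟪∇χ, Y⟫` for a compactly supported field `Y`. -/
lemma integral_mul_vectorDiv {χ : EuclideanSpace ℝ (Fin n) → ℝ} (hχ : ContDiff ℝ 1 χ)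
    (hY : ContDiff ℝ 1 Y) (hYc : HasCompactSupport Y) :
    ∫ x, χ x * vectorDiv Y x = -∫ x, fderiv ℝ χ x (Y x) := by
  have hYi : ∀ i, ContDiff ℝ 1 fun x => Y x i := fun i =>
    (EuclideanSpace.proj i : StrongDual ℝ (EuclideanSpace ℝ (Fin n))).contDiff.comp hY
  have hYic : ∀ i, HasCompactSupport fun x => Y x i := fun i =>
    hYc.comp_left (g := fun v : EuclideanSpace ℝ (Fin n) => v i) rfl
  have hfd : ∀ i x v, fderiv ℝ (fun x => Y x i) x v = (fderiv ℝ Y x v) i := fun i x v => by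
    have := (EuclideanSpace.proj i : StrongDual ℝ (EuclideanSpace ℝ (Fin n))).hasFDerivAt.comp x
      (hY.differentiable one_ne_zero x).hasFDerivAt
    exact congrArg (fun L => L v) this.fderiv
  have hχd : Continuous (fderiv ℝ χ) := hχ.continuous_fderiv one_ne_zero
  have hYd : ∀ i v, Continuous fun x => fderiv ℝ (fun x => Y x i) x v := fun i v =>
    ((hYi i).continuous_fderiv one_ne_zero).clm_apply continuous_const
  have hYdc : ∀ i v, HasCompactSupport fun x => fderiv ℝ (fun x => Y x i) x v := fun i v =>
    ((hYic i).fderiv ℝ).comp_left (g := fun L : EuclideanSpace ℝ (Fin n) →L[ℝ] ℝ => L v) rfl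
  have hint1 : ∀ i, Integrable fun x =>
      χ x * fderiv ℝ (fun x => Y x i) x (EuclideanSpace.single i 1) := fun i =>
    (hχ.continuous.mul (hYd i _)).integrable_of_hasCompactSupport (hYdc i _).mul_left
  have hint2 : ∀ i, Integrable fun x => fderiv ℝ χ x (EuclideanSpace.single i 1) * Y x i :=
    fun i => ((hχd.clm_apply continuous_const).mul (hYi i).continuous).integrable_of_hasCompactSupport
      (hYic i).mul_left
  have hint3 : ∀ i, Integrable fun x => χ x * Y x i := fun i =>
    (hχ.continuous.mul (hYi i).continuous).integrable_of_hasCompactSupport (hYic i).mul_left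
  calc ∫ x, χ x * vectorDiv Y x
      = ∑ i, ∫ x, χ x * fderiv ℝ (fun x => Y x i) x (EuclideanSpace.single i 1) := by
        rw [← integral_finsetSum _ fun i _ => hint1 i]
        refine integral_congr_ae (Filter.Eventually.of_forall fun x => ?_)
        simp only [hfd, vectorDiv, Finset.mul_sum]
    _ = ∑ i, -∫ x, fderiv ℝ χ x (EuclideanSpace.single i 1) * Y x i :=
        Finset.sum_congr rfl fun i _ => integral_mul_fderiv_eq_neg_fderiv_mul_of_integrable
          (hint2 i) (hint1 i) (hint3 i) (fun x _ => hχ.differentiable one_ne_zero x)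
          (fun x _ => (hYi i).differentiable one_ne_zero x)
    _ = -∫ x, fderiv ℝ χ x (Y x) := by
        rw [Finset.sum_neg_distrib, ← integral_finsetSum _ fun i _ => hint2 i]
        congr 1
        refine integral_congr_ae (Filter.Eventually.of_forall fun x => ?_)
        change _ = fderiv ℝ χ x (Y x)
        conv_rhs => rw [← (EuclideanSpace.basisFun (Fin n) ℝ).sum_repr (Y x), map_sum]
        refine Finset.sum_congr rfl fun i _ => ?_
        rw [map_smul, smul_eq_mul, mul_comm]
        simp

end Divergence

section Calibration

variable {n : ℕ} {r R : ℝ} {Ω : Set (EuclideanSpace ℝ (Fin n))}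

/-- A smooth decreasing profile that equals `1` on `(-∞, 1]` and `0` on `[1 + ε, ∞)`. -/
noncomputable def stepProfile (ε s : ℝ) : ℝ := Real.smoothTransition (1 - (s - 1) / ε)

lemma contDiff_stepProfile (ε : ℝ) : ContDiff ℝ 1 (stepProfile ε) :=
  (Real.smoothTransition.contDiff (n := 1)).comp
    (contDiff_const.sub ((contDiff_id.sub contDiff_const).div_const ε))

lemma stepProfile_eq_one {ε s : ℝ} (hε : 0 < ε) (hs : s ≤ 1) : stepProfile ε s = 1 :=
  Real.smoothTransition.one_of_one_le (by
    have := div_nonpos_of_nonpos_of_nonneg (sub_nonpos.2 hs) hε.le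
    linarith)

lemma stepProfile_eq_zero {ε s : ℝ} (hε : 0 < ε) (hs : 1 + ε ≤ s) : stepProfile ε s = 0 :=
  Real.smoothTransition.zero_of_nonpos (by
    rw [sub_nonpos, one_le_div hε]
    linarith)

lemma antitone_stepProfile {ε : ℝ} (hε : 0 < ε) : Antitone (stepProfile ε) := fun s t hst =>
  Real.smoothTransition.monotone (by gcongr)

lemma deriv_stepProfile_eq_zero {ε s : ℝ} (hε : 0 < ε) (hs : s < 1 ∨ 1 + ε < s) :
    deriv (stepProfile ε) s = 0 := by
  rcases hs with hs | hs
  · have : stepProfile ε =ᶠ[𝓝 s] fun _ => 1 := by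
      filter_upwards [gt_mem_nhds hs] with t ht using stepProfile_eq_one hε ht.le
    rw [this.deriv_eq, deriv_const]
  · have : stepProfile ε =ᶠ[𝓝 s] fun _ => 0 := by
      filter_upwards [lt_mem_nhds hs] with t ht using stepProfile_eq_zero hε ht.le
    rw [this.deriv_eq, deriv_const]

lemma stepProfile_gauge_eventuallyEq_one (hr : 0 < r) (hΩ : Ω ∈ starClass n r R) {ε : ℝ}
    (hε : 0 < ε) :
    (fun y => stepProfile ε (gauge Ω y)) =ᶠ[𝓝 (0 : EuclideanSpace ℝ (Fin n))] fun _ => 1 := by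
  have h := (continuous_gauge_of_mem_starClass hr hΩ).tendsto 0
  rw [gauge_zero] at h
  filter_upwards [h.eventually (gt_mem_nhds one_pos)] with y hy
    using stepProfile_eq_one hε (le_of_lt hy)

lemma contDiff_stepProfile_gauge (hr : 0 < r) (hR : 0 < R) (hΩ : Ω ∈ starClass n r R)
    (hs : HasSmoothBoundary Ω) {ε : ℝ} (hε : 0 < ε) :
    ContDiff ℝ 1 fun y => stepProfile ε (gauge Ω y) := by
  rw [contDiff_iff_contDiffAt]
  intro x
  rcases eq_or_ne x 0 with rfl | hx
  · exact contDiffAt_const.congr_of_eventuallyEq (stepProfile_gauge_eventuallyEq_one hr hΩ hε)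
  · exact (contDiff_stepProfile ε).contDiffAt.comp x
      ((contDiffAt_gauge hr hR hΩ hs hx).of_le (by simp))

lemma fderiv_stepProfile_gauge_nonneg (hr : 0 < r) (hR : 0 < R) (hΩ : Ω ∈ starClass n r R)
    (hs : HasSmoothBoundary Ω) {ε : ℝ} (hε : 0 < ε) {x v : EuclideanSpace ℝ (Fin n)}
    (hv : 1 ≤ gauge Ω x → gauge Ω x ≤ 1 + ε → inner ℝ (∇ (gauge Ω) x) v ≤ 0) :
    0 ≤ fderiv ℝ (fun y => stepProfile ε (gauge Ω y)) x v := by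
  rcases eq_or_ne x 0 with rfl | hx
  · rw [(stepProfile_gauge_eventuallyEq_one hr hΩ hε).fderiv_eq]
    simp
  have h1 := ((contDiff_stepProfile ε).differentiable one_ne_zero (gauge Ω x)).hasDerivAt
  have h2 := ((contDiffAt_gauge hr hR hΩ hs hx).differentiableAt (by simp)).hasFDerivAt
  have h3 : fderiv ℝ (fun y => stepProfile ε (gauge Ω y)) x =
      deriv (stepProfile ε) (gauge Ω x) • fderiv ℝ (gauge Ω) x :=
    (h1.comp_hasFDerivAt x h2).fderiv
  rw [h3, smul_apply, ← inner_gradient_left,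
    smul_eq_mul]
  by_cases hb : 1 ≤ gauge Ω x ∧ gauge Ω x ≤ 1 + ε
  · exact mul_nonneg_of_nonpos_of_nonpos (antitone_stepProfile hε).deriv_nonpos (hv hb.1 hb.2)
  · rw [deriv_stepProfile_eq_zero hε, zero_mul]
    by_contra! h
    exact hb h

/-- The divergence theorem as an inequality: a field that points inwards across the level sets of the
gauge just outside `Ω` has nonpositive total divergence in `Ω`. It is obtained by integrating by parts
against a smooth decreasing function of the gauge that approximates the indicator of `Ω`. -/
lemma setIntegral_vectorDiv_nonpos (hr : 0 < r) (hR : 0 < R) (hΩ : Ω ∈ starClass n r R)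
    (hs : HasSmoothBoundary Ω) {Y : EuclideanSpace ℝ (Fin n) → EuclideanSpace ℝ (Fin n)}
    (hY : ContDiff ℝ 1 Y) (hYc : HasCompactSupport Y)
    (hin : ∀ x, 1 ≤ gauge Ω x → gauge Ω x ≤ 2 → inner ℝ (∇ (gauge Ω) x) (Y x) ≤ 0) :
    ∫ x in Ω, vectorDiv Y x ≤ 0 := by
  have hcl : closure Ω =ᵐ[volume] Ω :=
    closure_ae_eq_of_null_frontier (volume_frontier_eq_zero hr hΩ)
  have hcont := continuous_gauge_of_mem_starClass hr hΩ
  rw [← Measure.restrict_congr_set hcl, ← integral_indicator isClosed_closure.measurableSet]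
  set ε : ℕ → ℝ := fun k => 1 / ((k : ℝ) + 1) with hεdef
  have hε : ∀ k, 0 < ε k := fun k => Nat.one_div_pos_of_nat
  have hε1 : ∀ k, ε k ≤ 1 := fun k => by
    rw [hεdef]
    exact (div_le_one (by positivity)).2 (by linarith [(Nat.cast_nonneg k : (0 : ℝ) ≤ k)])
  have hlim : Filter.Tendsto (fun k => ∫ x, stepProfile (ε k) (gauge Ω x) * vectorDiv Y x)
      Filter.atTop (𝓝 (∫ x, (closure Ω).indicator (vectorDiv Y) x)) := by
    refine tendsto_integral_of_dominated_convergence (fun x => ‖vectorDiv Y x‖) ?_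
      (integrable_vectorDiv hY hYc).norm ?_ ?_
    · exact fun k => (((contDiff_stepProfile _).continuous.comp hcont).mul
        (continuous_vectorDiv hY)).aestronglyMeasurable
    · refine fun k => Filter.Eventually.of_forall fun x => ?_
      rw [norm_mul]
      refine mul_le_of_le_one_left (norm_nonneg _) ?_
      rw [stepProfile, Real.norm_of_nonneg (Real.smoothTransition.nonneg _)]
      exact Real.smoothTransition.le_one _
    · refine Filter.Eventually.of_forall fun x => ?_
      rw [closure_eq_gauge_le_one hr hΩ]
      by_cases hx : gauge Ω x ≤ 1
      · rw [indicator_of_mem (by exact hx)]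
        simp only [stepProfile_eq_one (hε _) hx, one_mul]
        exact tendsto_const_nhds
      · rw [indicator_of_notMem (by exact hx)]
        have hx' : 0 < gauge Ω x - 1 := by linarith [not_le.1 hx]
        have hev : ∀ᶠ k in Filter.atTop, ε k < gauge Ω x - 1 :=
          tendsto_one_div_add_atTop_nhds_zero_nat.eventually (gt_mem_nhds hx')
        refine tendsto_const_nhds.congr' ?_
        filter_upwards [hev] with k hk
        rw [stepProfile_eq_zero (hε k) (by linarith), zero_mul]
  refine le_of_tendsto hlim (Filter.Eventually.of_forall fun k => ?_)
  rw [integral_mul_vectorDiv (contDiff_stepProfile_gauge hr hR hΩ hs (hε k)) hY hYc, neg_nonpos]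
  exact integral_nonneg fun x => fderiv_stepProfile_gauge_nonneg hr hR hΩ hs (hε k)
    fun h1 h2 => hin x h1 (by linarith [hε1 k])

/-- A test field whose component along `∇g` dominates `|∇g|` near the boundary bounds the
perimeter from above. -/
lemma perimeter_le_setIntegral_vectorDiv (hr : 0 < r) (hR : 0 < R) (hΩ : Ω ∈ starClass n r R)
    (hs : HasSmoothBoundary Ω) {Z : EuclideanSpace ℝ (Fin n) → EuclideanSpace ℝ (Fin n)}
    (hZ : ContDiff ℝ 1 Z) (hZc : HasCompactSupport Z)
    (hout : ∀ x, 1 ≤ gauge Ω x → gauge Ω x ≤ 2 →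
      ‖∇ (gauge Ω) x‖ ≤ inner ℝ (∇ (gauge Ω) x) (Z x)) :
    perimeter Ω ≤ ENNReal.ofReal (∫ x in Ω, vectorDiv Z x) := by
  refine iSup_le fun φ => iSup_le fun hφ => iSup_le fun hφc => iSup_le fun hφ1 =>
    ENNReal.ofReal_le_ofReal ?_
  have h := setIntegral_vectorDiv_nonpos hr hR hΩ hs (hφ.sub hZ) (hφc.sub hZc) fun x h1 h2 => by
    rw [inner_sub_right, sub_nonpos]
    calc inner ℝ (∇ (gauge Ω) x) (φ x) ≤ ‖∇ (gauge Ω) x‖ * ‖φ x‖ := real_inner_le_norm _ _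
      _ ≤ ‖∇ (gauge Ω) x‖ := mul_le_of_le_one_right (norm_nonneg _) (hφ1 x)
      _ ≤ _ := hout x h1 h2
  have h2 : ∫ x in Ω, vectorDiv (φ - Z) x =
      (∫ x in Ω, vectorDiv φ x) - ∫ x in Ω, vectorDiv Z x := by
    rw [← integral_sub (integrable_vectorDiv hφ hφc).restrict
      (integrable_vectorDiv hZ hZc).restrict]
    congr 1
    ext x
    exact vectorDiv_sub (hφ.differentiable one_ne_zero x) (hZ.differentiable one_ne_zero x)
  have h3 : ∫ x in Ω, vectorDiv (φ - Z) x ≤ 0 := h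
  linarith

/-- The field `x / r`, cut off outside `B_{2R}`, bounds the perimeters in the class `S_{r,R}`
uniformly. -/
lemma exists_perimeter_le (n : ℕ) (hr : 0 < r) (hR : 0 < R) :
    ∃ M : ℝ≥0∞, M ≠ ⊤ ∧ ∀ Ω ∈ starClass n r R, HasSmoothBoundary Ω → perimeter Ω ≤ M := by
  let b : ContDiffBump (0 : EuclideanSpace ℝ (Fin n)) := ⟨2 * R, 3 * R, by positivity, by linarith⟩
  set Z : EuclideanSpace ℝ (Fin n) → EuclideanSpace ℝ (Fin n) := fun x => b x • (r⁻¹ • x) with hZdef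
  have hZ : ContDiff ℝ 1 Z := b.contDiff.smul (contDiff_const_smul _)
  have hZc : HasCompactSupport Z := b.hasCompactSupport.smul_right
  refine ⟨ENNReal.ofReal (∫ x, ‖vectorDiv Z x‖), ENNReal.ofReal_ne_top, fun Ω hΩ hs => ?_⟩
  refine (perimeter_le_setIntegral_vectorDiv hr hR hΩ hs hZ hZc fun x h1 h2 => ?_).trans
    (ENNReal.ofReal_le_ofReal ?_)
  · have hx0 : x ≠ 0 := by
      rintro rfl
      rw [gauge_zero] at h1
      linarith
    have hxn : ‖x‖ ≤ 2 * R := by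
      have := norm_le_mul_gauge hr hR hΩ x
      nlinarith
    have hb : b x = 1 := b.one_of_mem_closedBall (mem_closedBall_zero_iff.2 hxn)
    have hd := (contDiffAt_gauge hr hR hΩ hs hx0).differentiableAt (by simp)
    rw [hZdef]
    simp only
    rw [hb, one_smul, real_inner_smul_right, inner_gradient_gauge_self hd]
    refine (norm_gradient_gauge_le hr hΩ).trans ?_
    rw [one_div]
    exact le_mul_of_one_le_right (by positivity) h1
  · refine (Real.le_norm_self _).trans ((norm_integral_le_integral_norm _).trans ?_)
    exact setIntegral_le_integral (integrable_vectorDiv hZ hZc).norm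
      (Filter.Eventually.of_forall fun x => norm_nonneg _)

end Calibration

/-! ### Radial projection of shells onto the boundary -/

section RadialProjection

variable {n : ℕ} {r R : ℝ} {Ω : Set (EuclideanSpace ℝ (Fin n))}

/-- The radial projection of `x ≠ 0` to the boundary of a star-shaped set `Ω`. -/
noncomputable def radialProj (Ω : Set (EuclideanSpace ℝ (Fin n)))
    (x : EuclideanSpace ℝ (Fin n)) : EuclideanSpace ℝ (Fin n) :=
  (gauge Ω x)⁻¹ • x

/-- The shell `{a ≤ g ≤ b}` between two level sets of the gauge `g` of `Ω`. -/
def gaugeShell (Ω : Set (EuclideanSpace ℝ (Fin n))) (a b : ℝ) :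
    Set (EuclideanSpace ℝ (Fin n)) :=
  {x | a ≤ gauge Ω x ∧ gauge Ω x ≤ b}

lemma measurable_radialProj (hr : 0 < r) (hΩ : Ω ∈ starClass n r R) :
    Measurable (radialProj Ω) :=
  (continuous_gauge_of_mem_starClass hr hΩ).measurable.inv.smul measurable_id

lemma measurableSet_gaugeShell (hr : 0 < r) (hΩ : Ω ∈ starClass n r R) (a b : ℝ) :
    MeasurableSet (gaugeShell Ω a b) :=
  ((isClosed_le continuous_const (continuous_gauge_of_mem_starClass hr hΩ)).inter
    (isClosed_le (continuous_gauge_of_mem_starClass hr hΩ) continuous_const)).measurableSet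

lemma ne_zero_of_mem_gaugeShell {a b : ℝ} (ha : 0 < a) {x : EuclideanSpace ℝ (Fin n)}
    (hx : x ∈ gaugeShell Ω a b) : x ≠ 0 := by
  rintro rfl
  have := hx.1
  rw [gauge_zero] at this
  linarith

/-- The part of a shell over a boundary piece of diameter `d` lies in a tube of width of order `d`
and length of order `b - a`; it is covered by about `(b - a) / d` balls of radius `(b + R) d`. -/
lemma volume_shell_inter_preimage_le (hn : 1 ≤ n) (hr : 0 < r) (hR : 0 < R)
    (hΩ : Ω ∈ starClass n r R) {a b d : ℝ} (ha : 0 < a) (hd : 0 < d) (hdab : d ≤ b - a)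
    {s : Set (EuclideanSpace ℝ (Fin n))} (hs : ∀ x ∈ s, ∀ y ∈ s, dist x y ≤ d) :
    volume (radialProj Ω ⁻¹' s ∩ gaugeShell Ω a b) ≤
      ENNReal.ofReal (2 * (b - a) * (b + R) ^ n) *
        volume (Metric.ball (0 : EuclideanSpace ℝ (Fin n)) 1) * ENNReal.ofReal d ^ (n - 1) := by
  rcases (radialProj Ω ⁻¹' s ∩ gaugeShell Ω a b).eq_empty_or_nonempty with he | ⟨x₀, hx₀s, hx₀⟩
  · rw [he, measure_empty]
    exact zero_le
  have hb : 0 < b := by linarith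
  set y₀ := radialProj Ω x₀ with hy₀
  have hx₀0 := ne_zero_of_mem_gaugeShell ha hx₀
  have hy₀n : ‖y₀‖ ≤ R := by
    have h1 := smul_inv_gauge_mem_frontier hr hR hΩ hx₀0
    rw [frontier_eq_gauge_eq_one hr hΩ, mem_ofPred_eq] at h1
    have := norm_le_mul_gauge hr hR hΩ y₀
    rwa [hy₀, radialProj, h1, mul_one] at this
  set N := ⌊(b - a) / d⌋₊ with hN
  have hcover : radialProj Ω ⁻¹' s ∩ gaugeShell Ω a b ⊆
      ⋃ k ∈ Finset.range (N + 1), Metric.closedBall ((a + k * d) • y₀) ((b + R) * d) := by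
    rintro x ⟨hxs, hx⟩
    set τ := gauge Ω x with hτ
    have hτ0 : 0 < τ := ha.trans_le hx.1
    have hxe : x = τ • radialProj Ω x := by
      rw [radialProj, smul_smul, mul_inv_cancel₀ hτ0.ne', one_smul]
    have hq0 : 0 ≤ (τ - a) / d := div_nonneg (sub_nonneg.2 hx.1) hd.le
    rw [mem_iUnion₂]
    refine ⟨⌊(τ - a) / d⌋₊, ?_, ?_⟩
    · rw [Finset.mem_range, Nat.lt_succ_iff]
      exact Nat.floor_mono (by gcongr; exact hx.2)
    · set k : ℝ := (⌊(τ - a) / d⌋₊ : ℝ) with hk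
      have hk1 : k * d ≤ τ - a := by
        rw [← le_div_iff₀ hd]; exact Nat.floor_le hq0
      have hk2 : τ - a < (k + 1) * d := by
        rw [← div_lt_iff₀ hd]; exact Nat.lt_floor_add_one _
      have hdist := hs _ hxs _ hx₀s
      rw [dist_eq_norm, ← hy₀] at hdist
      rw [mem_closedBall_iff_norm]
      have hdec : x - (a + k * d) • y₀ =
          τ • (radialProj Ω x - y₀) + (τ - (a + k * d)) • y₀ := by
        conv_lhs => rw [hxe]
        module
      rw [hdec]
      refine (norm_add_le _ _).trans ?_
      rw [norm_smul, norm_smul, Real.norm_of_nonneg hτ0.le,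
        Real.norm_of_nonneg (show 0 ≤ τ - (a + k * d) by linarith), add_mul]
      have h1 : τ * ‖radialProj Ω x - y₀‖ ≤ b * d := by gcongr; exact hx.2
      have h2 : (τ - (a + k * d)) * ‖y₀‖ ≤ d * R := by gcongr; linarith
      linarith
  have hNle : ((N + 1 : ℕ) : ℝ) ≤ 2 * (b - a) / d := by
    have h1 : (N : ℝ) ≤ (b - a) / d := Nat.floor_le (by
      have : 0 ≤ b - a := by linarith
      positivity)
    have h2 : 1 ≤ (b - a) / d := (one_le_div hd).2 hdab
    push_cast
    rw [mul_div_assoc]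
    linarith
  calc volume (radialProj Ω ⁻¹' s ∩ gaugeShell Ω a b)
      ≤ ∑ k ∈ Finset.range (N + 1),
          volume (Metric.closedBall ((a + k * d) • y₀) ((b + R) * d)) :=
        (measure_mono hcover).trans (measure_biUnion_finset_le _ _)
    _ = ENNReal.ofReal ((N + 1 : ℕ) * ((b + R) * d) ^ n) *
          volume (Metric.ball (0 : EuclideanSpace ℝ (Fin n)) 1) := by
        have hball : ∀ k : ℕ, volume (Metric.closedBall ((a + k * d) • y₀) ((b + R) * d)) =
            ENNReal.ofReal (((b + R) * d) ^ n) *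
              volume (Metric.ball (0 : EuclideanSpace ℝ (Fin n)) 1) := fun k => by
          rw [Measure.addHaar_closedBall _ _ (by positivity), finrank_euclideanSpace_fin]
        simp only [hball, Finset.sum_const, Finset.card_range, nsmul_eq_mul]
        rw [ENNReal.ofReal_mul (by positivity), ENNReal.ofReal_natCast, mul_assoc]
    _ ≤ ENNReal.ofReal (2 * (b - a) * (b + R) ^ n * d ^ (n - 1)) *
          volume (Metric.ball (0 : EuclideanSpace ℝ (Fin n)) 1) := by
        refine mul_le_mul' (ENNReal.ofReal_le_ofReal ?_) le_rfl
        calc ((N + 1 : ℕ) : ℝ) * ((b + R) * d) ^ n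
            ≤ 2 * (b - a) / d * ((b + R) * d) ^ n := by gcongr
          _ = 2 * (b - a) * (b + R) ^ n * d ^ (n - 1) := by
            obtain ⟨m, rfl⟩ : ∃ m, n = m + 1 := ⟨n - 1, by omega⟩
            rw [mul_pow, Nat.add_sub_cancel, pow_succ d m]
            field_simp
    _ = _ := by
        rw [ENNReal.ofReal_mul' (by positivity), ENNReal.ofReal_pow hd.le]
        ring

/-- The image of the volume of a shell under radial projection is bounded by the Hausdorff measure
of dimension `n - 1`, with a factor proportional to the thickness of the shell. -/
lemma map_radialProj_le_hausdorffMeasure (hn : 2 ≤ n) (hr : 0 < r) (hR : 0 < R)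
    (hΩ : Ω ∈ starClass n r R) {a b : ℝ} (ha : 0 < a) (hab : a < b) :
    (volume.restrict (gaugeShell Ω a b)).map (radialProj Ω) ≤
      (ENNReal.ofReal (2 * (b - a) * (b + R) ^ n) *
        volume (Metric.ball (0 : EuclideanSpace ℝ (Fin n)) 1)) • μH[(n - 1 : ℕ)] := by
  set ν := (volume.restrict (gaugeShell Ω a b)).map (radialProj Ω) with hν
  set c := ENNReal.ofReal (2 * (b - a) * (b + R) ^ n) *
    volume (Metric.ball (0 : EuclideanSpace ℝ (Fin n)) 1) with hc
  have hb : 0 < b := ha.trans hab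
  have hba : 0 < b - a := sub_pos.2 hab
  have hc0 : c ≠ 0 := by
    refine mul_ne_zero ?_ (Metric.measure_ball_pos _ _ one_pos).ne'
    rw [ENNReal.ofReal_ne_zero_iff]
    positivity
  have hctop : c ≠ ⊤ := ENNReal.mul_ne_top ENNReal.ofReal_ne_top measure_ball_lt_top.ne
  have key : ∀ s : Set (EuclideanSpace ℝ (Fin n)), ∀ d : ℝ, 0 < d → d ≤ b - a →
      Metric.ediam s ≤ ENNReal.ofReal d → ν s ≤ c * ENNReal.ofReal d ^ (n - 1) := by
    intro s d hd hdab hs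
    refine (measure_mono subset_closure).trans ?_
    rw [hν, Measure.map_apply (measurable_radialProj hr hΩ) isClosed_closure.measurableSet,
      Measure.restrict_apply (measurable_radialProj hr hΩ isClosed_closure.measurableSet)]
    refine volume_shell_inter_preimage_le (by omega) hr hR hΩ ha hd hdab fun x hx y hy => ?_
    rw [← ENNReal.ofReal_le_ofReal_iff hd.le, ← edist_dist]
    exact (Metric.edist_le_ediam_of_mem hx hy).trans ((Metric.ediam_closure s).trans_le hs)
  have hmain : c⁻¹ • ν ≤ μH[(n - 1 : ℕ)] := by
    refine Measure.le_hausdorffMeasure _ _ (ENNReal.ofReal (b - a)) (ENNReal.ofReal_pos.2 hba)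
      fun s hs => ?_
    rw [Measure.smul_apply, smul_eq_mul, ENNReal.rpow_natCast, mul_comm, ← div_eq_mul_inv]
    refine ENNReal.div_le_of_le_mul' ?_
    have hfin : Metric.ediam s ≠ ⊤ := (hs.trans_lt ENNReal.ofReal_lt_top).ne
    rcases eq_or_ne (Metric.ediam s) 0 with h0 | h0
    · -- A set of diameter zero is estimated with every small `d`.
      have hle : ∀ᶠ d : ℝ in 𝓝[>] 0, ν s ≤ c * ENNReal.ofReal d ^ (n - 1) := by
        filter_upwards [Ioo_mem_nhdsGT hba] with d hd
        exact key s d hd.1 hd.2.le (by rw [h0]; exact zero_le)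
      have ht : Filter.Tendsto (fun d : ℝ => c * ENNReal.ofReal d ^ (n - 1)) (𝓝[>] 0)
          (𝓝 (c * Metric.ediam s ^ (n - 1))) := by
        have h1 : Filter.Tendsto (fun d : ℝ => ENNReal.ofReal d ^ (n - 1)) (𝓝 0)
            (𝓝 (ENNReal.ofReal 0 ^ (n - 1))) :=
          ((ENNReal.continuous_pow _).comp ENNReal.continuous_ofReal).tendsto 0
        rw [h0]
        rw [ENNReal.ofReal_zero] at h1
        exact ENNReal.Tendsto.const_mul (h1.mono_left nhdsWithin_le_nhds) (Or.inr hctop)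
      exact ge_of_tendsto ht hle
    · have := key s (Metric.ediam s).toReal (ENNReal.toReal_pos h0 hfin)
        (ENNReal.toReal_le_of_le_ofReal hba.le hs) (ENNReal.ofReal_toReal hfin).ge
      rwa [ENNReal.ofReal_toReal hfin] at this
  calc ν = c • (c⁻¹ • ν) := by rw [smul_smul, ENNReal.mul_inv_cancel hc0 hctop, one_smul]
    _ ≤ c • μH[(n - 1 : ℕ)] := by gcongr

lemma ae_map_radialProj_mem_frontier (hr : 0 < r) (hR : 0 < R) (hΩ : Ω ∈ starClass n r R)
    {a b : ℝ} (ha : 0 < a) :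
    ∀ᵐ y ∂(volume.restrict (gaugeShell Ω a b)).map (radialProj Ω), y ∈ frontier Ω := by
  refine (ae_map_iff (p := fun y => y ∈ frontier Ω) (measurable_radialProj hr hΩ).aemeasurable
    (by exact isClosed_frontier.measurableSet)).2 ?_
  filter_upwards [ae_restrict_mem (measurableSet_gaugeShell hr hΩ a b)] with x hx
    using smul_inv_gauge_mem_frontier hr hR hΩ (ne_zero_of_mem_gaugeShell ha hx)

/-- Integrals over a shell of functions that are constant along rays are controlled by surface
integrals over the boundary. -/
lemma lintegral_comp_radialProj_le (hn : 2 ≤ n) (hr : 0 < r) (hR : 0 < R)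
    (hΩ : Ω ∈ starClass n r R) {a b : ℝ} (ha : 0 < a) (hab : a < b)
    {F : EuclideanSpace ℝ (Fin n) → ℝ≥0∞} (hF : AEMeasurable F
      ((volume.restrict (gaugeShell Ω a b)).map (radialProj Ω))) :
    ∫⁻ x in gaugeShell Ω a b, F (radialProj Ω x) ≤
      (ENNReal.ofReal (2 * (b - a) * (b + R) ^ n) *
        volume (Metric.ball (0 : EuclideanSpace ℝ (Fin n)) 1)) *
        ∫⁻ y in frontier Ω, F y ∂μH[(n - 1 : ℕ)] := by
  rw [← lintegral_map' hF (measurable_radialProj hr hΩ).aemeasurable,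
    ← Measure.restrict_eq_self_of_ae_mem (ae_map_radialProj_mem_frontier hr hR hΩ ha),
    ← smul_eq_mul, ← lintegral_smul_measure, ← Measure.restrict_smul]
  exact lintegral_mono' (Measure.restrict_mono subset_rfl
    (map_radialProj_le_hausdorffMeasure hn hr hR hΩ ha hab)) le_rfl

end RadialProjection

/-! ### Comparison of the perimeters of two star-shaped sets -/

section Comparison

variable {n : ℕ} {r R : ℝ} {Ω Ω' : Set (EuclideanSpace ℝ (Fin n))}

/-- The square of the divergence of the normal field, integrated over the boundary, is the curvature
energy up to the normalization of the Hausdorff measure. -/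
lemma lintegral_sq_vectorDiv_gauge_eq (hr : 0 < r) (hR : 0 < R) (hΩ : Ω ∈ starClass n r R)
    (hs : HasSmoothBoundary Ω) :
    ∫⁻ y in frontier Ω, ENNReal.ofReal (vectorDiv (unitGradient (gauge Ω)) y ^ 2)
      ∂μH[(n - 1 : ℕ)] =
    (Measure.addHaarScalarFactor (volume : Measure (EuclideanSpace ℝ (Fin (n - 1))))
      μH[(n - 1 : ℕ)] : ℝ≥0∞)⁻¹ * curvatureEnergy Ω := by
  have hκ := Measure.addHaarScalarFactor_volume_hausdorffMeasure_ne_zero (n - 1)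
  have h1 : ∫⁻ y in frontier Ω, ENNReal.ofReal (vectorDiv (unitGradient (gauge Ω)) y ^ 2)
      ∂μH[(n - 1 : ℕ)] = ∫⁻ y in frontier Ω, ENNReal.ofReal (meanCurvature Ω y ^ 2)
      ∂μH[(n - 1 : ℕ)] :=
    setLIntegral_congr_fun isClosed_frontier.measurableSet fun y hy => by
      simp only [meanCurvature_eq_vectorDiv_gauge hr hR hΩ hs hy]
  rw [h1, curvatureEnergy, Measure.euclideanHausdorffMeasure_def, ENNReal.smul_def,
    Measure.restrict_smul, lintegral_smul_measure, smul_eq_mul, ← mul_assoc,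
    ENNReal.inv_mul_cancel (by exact_mod_cast hκ) ENNReal.coe_ne_top, one_mul]

/-- The divergence of the normal field has integral of order `δ` over a shell of thickness `δ`. -/
lemma exists_lintegral_vectorDiv_shell_le (hn : 2 ≤ n) (hr : 0 < r) (hR : 0 < R) (K : ℝ) :
    ∃ C : ℝ≥0∞, C ≠ ⊤ ∧ ∀ Ω ∈ starClass n r R, HasSmoothBoundary Ω → ∀ δ, 0 < δ → δ ≤ K →
      ∫⁻ x in gaugeShell Ω (1 + δ)⁻¹ (1 + δ), ‖vectorDiv (unitGradient (gauge Ω)) x‖ₑ ≤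
        ENNReal.ofReal δ * C * (1 + curvatureEnergy Ω) := by
  set κ : ℝ≥0∞ := (Measure.addHaarScalarFactor
    (volume : Measure (EuclideanSpace ℝ (Fin (n - 1)))) μH[(n - 1 : ℕ)] : ℝ≥0∞)⁻¹ with hκ
  have hκtop : κ ≠ ⊤ := ENNReal.inv_ne_top.2 (by
    exact_mod_cast Measure.addHaarScalarFactor_volume_hausdorffMeasure_ne_zero (n - 1))
  set A : ℝ≥0∞ := ENNReal.ofReal (n * (1 + 2 * K) ^ (n - 1) * 3) *
    volume (Metric.ball (0 : EuclideanSpace ℝ (Fin n)) R) with hA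
  set B : ℝ≥0∞ := ENNReal.ofReal (4 * (1 + K + R) ^ n) *
    volume (Metric.ball (0 : EuclideanSpace ℝ (Fin n)) 1) with hB
  have hAtop : A ≠ ⊤ := ENNReal.mul_ne_top ENNReal.ofReal_ne_top measure_ball_lt_top.ne
  have hBtop : B ≠ ⊤ := ENNReal.mul_ne_top ENNReal.ofReal_ne_top measure_ball_lt_top.ne
  refine ⟨ENNReal.ofReal (1 + K) * (A + B * κ), ENNReal.mul_ne_top ENNReal.ofReal_ne_top
    (ENNReal.add_ne_top.2 ⟨hAtop, ENNReal.mul_ne_top hBtop hκtop⟩), fun Ω hΩ hs δ hδ hδK => ?_⟩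
  set h := vectorDiv (unitGradient (gauge Ω)) with hh
  set a : ℝ := (1 + δ)⁻¹ with ha
  have ha0 : 0 < a := by positivity
  have ha1 : 1 - δ ≤ a := by
    rw [ha, ← one_div, le_div_iff₀ (by positivity)]
    nlinarith
  have hab : a < 1 + δ := (inv_le_one_of_one_le₀ (by linarith)).trans_lt (by linarith)
  have hpt : ∀ x ∈ gaugeShell Ω a (1 + δ), ‖h x‖ₑ ≤
      ENNReal.ofReal (1 + K) * (1 + ENNReal.ofReal (h (radialProj Ω x) ^ 2)) := by
    intro x hx
    have hg : 0 < gauge Ω x := ha0.trans_le hx.1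
    have hhom : (gauge Ω x)⁻¹ * h (radialProj Ω x) = h x :=
      vectorDiv_unitGradient_gauge_smul (inv_pos.2 hg)
    have hginv : (gauge Ω x)⁻¹ ≤ 1 + K := by
      refine (inv_anti₀ ha0 hx.1).trans ?_
      rw [ha, inv_inv]
      linarith
    rw [← ENNReal.ofReal_one, ← ENNReal.ofReal_add zero_le_one (sq_nonneg _),
      ← ENNReal.ofReal_mul (by linarith), ← ofReal_norm, ← hhom, norm_mul,
      Real.norm_of_nonneg (inv_pos.2 hg).le]
    refine ENNReal.ofReal_le_ofReal (mul_le_mul hginv ?_ (norm_nonneg _) (by linarith))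
    rw [Real.norm_eq_abs]
    nlinarith [sq_nonneg (|h (radialProj Ω x)| - 1), sq_abs (h (radialProj Ω x))]
  have hmeasF : AEMeasurable (fun y => ENNReal.ofReal (h y ^ 2))
      ((volume.restrict (gaugeShell Ω a (1 + δ))).map (radialProj Ω)) := by
    have h1 : AEMeasurable h
        ((volume.restrict (gaugeShell Ω a (1 + δ))).map (radialProj Ω)) := by
      rw [← Measure.restrict_eq_self_of_ae_mem (ae_map_radialProj_mem_frontier hr hR hΩ ha0)]
      exact ((continuousOn_vectorDiv_unitGradient_gauge hr hR hΩ hs).mono fun y hy =>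
        ne_zero_of_mem_frontier hr hΩ hy).aemeasurable isClosed_frontier.measurableSet
    exact (h1.pow_const 2).ennreal_ofReal
  have hvol : volume (gaugeShell Ω a (1 + δ)) ≤ ENNReal.ofReal δ * A := by
    refine (measure_mono fun x hx => ?_).trans ((volume_gauge_shell_le hr hΩ (a := a)
      (b := 1 + 2 * δ) ha0 (by linarith)).trans ?_)
    · exact ⟨hx.1, hx.2.trans_lt (by linarith)⟩
    · rw [hA, ← mul_assoc, ← ENNReal.ofReal_mul hδ.le]
      refine mul_le_mul' (ENNReal.ofReal_le_ofReal ?_) le_rfl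
      calc n * (1 + 2 * δ) ^ (n - 1) * (1 + 2 * δ - a)
          ≤ n * (1 + 2 * K) ^ (n - 1) * (3 * δ) := by
            refine mul_le_mul ?_ (by linarith) (by linarith)
              (mul_nonneg n.cast_nonneg (pow_nonneg (by linarith) _))
            gcongr
        _ = δ * (n * (1 + 2 * K) ^ (n - 1) * 3) := by ring
  have hsurf : ∫⁻ x in gaugeShell Ω a (1 + δ), ENNReal.ofReal (h (radialProj Ω x) ^ 2) ≤
      ENNReal.ofReal δ * B * (κ * curvatureEnergy Ω) := by
    refine (lintegral_comp_radialProj_le hn hr hR hΩ ha0 hab hmeasF).trans ?_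
    rw [lintegral_sq_vectorDiv_gauge_eq hr hR hΩ hs]
    refine mul_le_mul' ?_ le_rfl
    rw [hB, ← mul_assoc, ← ENNReal.ofReal_mul hδ.le]
    refine mul_le_mul' (ENNReal.ofReal_le_ofReal ?_) le_rfl
    calc 2 * (1 + δ - a) * (1 + δ + R) ^ n ≤ 2 * (2 * δ) * (1 + K + R) ^ n := by
          gcongr; linarith
      _ = δ * (4 * (1 + K + R) ^ n) := by ring
  calc ∫⁻ x in gaugeShell Ω a (1 + δ), ‖h x‖ₑ
      ≤ ∫⁻ x in gaugeShell Ω a (1 + δ),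
          ENNReal.ofReal (1 + K) * (1 + ENNReal.ofReal (h (radialProj Ω x) ^ 2)) :=
        setLIntegral_mono' (measurableSet_gaugeShell hr hΩ _ _) hpt
    _ = ENNReal.ofReal (1 + K) * (volume (gaugeShell Ω a (1 + δ)) +
          ∫⁻ x in gaugeShell Ω a (1 + δ), ENNReal.ofReal (h (radialProj Ω x) ^ 2)) := by
        rw [lintegral_const_mul' _ _ ENNReal.ofReal_ne_top, lintegral_add_left measurable_const,
          setLIntegral_one]
    _ ≤ ENNReal.ofReal (1 + K) * (ENNReal.ofReal δ * A +
          ENNReal.ofReal δ * B * (κ * curvatureEnergy Ω)) := by gcongr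
    _ = ENNReal.ofReal δ * (ENNReal.ofReal (1 + K) *
          (A * 1 + B * κ * curvatureEnergy Ω)) := by ring
    _ ≤ ENNReal.ofReal δ * (ENNReal.ofReal (1 + K) *
          (A * (1 + curvatureEnergy Ω) + B * κ * (1 + curvatureEnergy Ω))) := by
        gcongr
        · exact le_self_add
        · exact le_add_self
    _ = _ := by ring

lemma hausdorffEDist_ne_top_of_mem_starClass (hr : 0 < r) (hΩ : Ω ∈ starClass n r R)
    (hΩ' : Ω' ∈ starClass n r R) : Metric.hausdorffEDist Ω Ω' ≠ ⊤ :=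
  Metric.hausdorffEDist_ne_top_of_nonempty_of_bounded
    ⟨0, ball_subset_of_mem_starClass hΩ (Metric.mem_ball_self hr)⟩
    ⟨0, ball_subset_of_mem_starClass hΩ' (Metric.mem_ball_self hr)⟩ hΩ.1.1 hΩ'.1.1

/-- Two star-shaped sets at Hausdorff distance less than `δ * r` differ only in a shell of relative
thickness `δ` around the boundary of the first. -/
lemma mem_gaugeShell_of_mem_symmDiff (hr : 0 < r) (hΩ : Ω ∈ starClass n r R)
    (hΩ' : Ω' ∈ starClass n r R) {δ : ℝ} (hδ : 0 < δ)
    (hd : Metric.hausdorffDist Ω Ω' < δ * r) {x : EuclideanSpace ℝ (Fin n)}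
    (hx : (x ∈ Ω ∧ x ∉ Ω') ∨ (x ∈ Ω' ∧ x ∉ Ω)) : x ∈ gaugeShell Ω (1 + δ)⁻¹ (1 + δ) := by
  have hfin := hausdorffEDist_ne_top_of_mem_starClass hr hΩ hΩ'
  have h1 : (0 : ℝ) < 1 + δ := by linarith
  rcases hx with ⟨hx, hx'⟩ | ⟨hx', hx⟩
  · refine ⟨?_, (gauge_le_one_of_mem hx).trans (by linarith)⟩
    by_contra! hlt
    have hmem : (1 + δ) • x ∈ Ω := by
      refine interior_subset (s := Ω) ?_
      rw [interior_eq_gauge_lt_one hr hΩ, mem_ofPred_eq, gauge_smul_nonneg h1.le]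
      rw [← one_div, lt_div_iff₀ h1] at hlt
      linarith
    obtain ⟨z, hz, hxz⟩ := Metric.exists_dist_lt_of_hausdorffDist_lt hmem hd hfin
    have := mem_dilation_of_dist_lt hΩ' hδ hz hxz
    rw [Set.smul_mem_smul_set_iff₀ h1.ne'] at this
    exact hx' this
  · obtain ⟨z, hz, hxz⟩ := Metric.exists_dist_lt_of_hausdorffDist_lt' hx' hd hfin
    rw [dist_comm] at hxz
    refine ⟨(inv_le_one_of_one_le₀ (by linarith)).trans ?_,
      gauge_le_of_mem h1.le (mem_dilation_of_dist_lt hΩ hδ hz hxz)⟩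
    by_contra! hlt
    refine hx (interior_subset ?_)
    rw [interior_eq_gauge_lt_one hr hΩ]
    exact hlt

end Comparison

section PerimeterComparison

variable {n : ℕ} {r R : ℝ} {Ω Ω' : Set (EuclideanSpace ℝ (Fin n))}

lemma norm_unitGradient_le_one (g : EuclideanSpace ℝ (Fin n) → ℝ)
    (x : EuclideanSpace ℝ (Fin n)) : ‖unitGradient g x‖ ≤ 1 := by
  rw [unitGradient, norm_smul, norm_inv, norm_norm]
  exact inv_mul_le_one

lemma inner_gradient_unitGradient (g : EuclideanSpace ℝ (Fin n) → ℝ)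
    (x : EuclideanSpace ℝ (Fin n)) : inner ℝ (∇ g x) (unitGradient g x) = ‖∇ g x‖ := by
  rw [unitGradient, real_inner_smul_right, real_inner_self_eq_norm_sq]
  rcases eq_or_ne ‖∇ g x‖ 0 with h | h
  · rw [h]; simp
  · field_simp

lemma exists_annular_cutoff (n : ℕ) (hr : 0 < r) (hrR : r < R) :
    ∃ η : EuclideanSpace ℝ (Fin n) → ℝ, ContDiff ℝ 1 η ∧ HasCompactSupport η ∧
      (∀ x, 0 ≤ η x ∧ η x ≤ 1) ∧ (∀ x, r / 2 ≤ ‖x‖ → ‖x‖ ≤ 2 * R → η x = 1) ∧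
      η =ᶠ[𝓝 0] 0 := by
  have hR : 0 < R := hr.trans hrR
  let b₁ : ContDiffBump (0 : EuclideanSpace ℝ (Fin n)) :=
    ⟨2 * R, 3 * R, by positivity, by linarith⟩
  let b₀ : ContDiffBump (0 : EuclideanSpace ℝ (Fin n)) :=
    ⟨r / 4, r / 2, by positivity, by linarith⟩
  refine ⟨fun x => b₁ x * (1 - b₀ x), b₁.contDiff.mul (contDiff_const.sub b₀.contDiff),
    b₁.hasCompactSupport.mul_right, fun x => ⟨?_, ?_⟩, fun x h1 h2 => ?_, ?_⟩
  · exact mul_nonneg b₁.nonneg (sub_nonneg.2 b₀.le_one)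
  · exact mul_le_one₀ b₁.le_one (sub_nonneg.2 b₀.le_one) (sub_le_self _ b₀.nonneg)
  · change b₁ x * (1 - b₀ x) = 1
    rw [b₁.one_of_mem_closedBall (mem_closedBall_zero_iff.2 h2),
      b₀.zero_of_le_dist (by rw [dist_zero_right]; exact h1), sub_zero, one_mul]
  · filter_upwards [b₀.eventuallyEq_one] with x hx
    rw [hx]
    simp

/-- Calibration: the normal field of `Ω`, extended constantly along rays, is a test field that is
optimal for `Ω` and admissible for `Ω'`. Hence the perimeters differ by at most the integral of its
divergence over the set where `Ω` and `Ω'` differ. -/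
lemma perimeter_le_perimeter_add (hr : 0 < r) (hrR : r < R) (hΩ : Ω ∈ starClass n r R)
    (hΩ' : Ω' ∈ starClass n r R) (hs : HasSmoothBoundary Ω) {δ : ℝ} (hδ : 0 < δ)
    (hd : Metric.hausdorffDist Ω Ω' < δ * r) :
    perimeter Ω ≤ perimeter Ω' + ∫⁻ x in gaugeShell Ω (1 + δ)⁻¹ (1 + δ),
      ‖vectorDiv (unitGradient (gauge Ω)) x‖ₑ := by
  have hR : 0 < R := hr.trans hrR
  obtain ⟨η, hη, hηc, hη01, hη1, hη0⟩ := exists_annular_cutoff n hr hrR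
  set X := unitGradient (gauge Ω) with hX
  set Z : EuclideanSpace ℝ (Fin n) → EuclideanSpace ℝ (Fin n) := fun x => η x • X x with hZdef
  have hZ : ContDiff ℝ 1 Z := by
    rw [contDiff_iff_contDiffAt]
    intro x
    rcases eq_or_ne x 0 with rfl | hx
    · refine (contDiffAt_const (c := (0 : EuclideanSpace ℝ (Fin n)))).congr_of_eventuallyEq ?_
      filter_upwards [hη0] with y hy
      rw [hZdef]
      simp [hy]
    · exact hη.contDiffAt.smul ((contDiffAt_unitGradient (contDiffAt_gauge hr hR hΩ hs hx)
        (gradient_gauge_ne_zero hr hR hΩ hs hx)).of_le (by simp))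
  have hZc : HasCompactSupport Z := hηc.smul_right
  have hZ1 : ∀ x, ‖Z x‖ ≤ 1 := fun x => by
    rw [hZdef]
    simp only
    rw [norm_smul, Real.norm_of_nonneg (hη01 x).1]
    exact mul_le_one₀ (hη01 x).2 (norm_nonneg _) (norm_unitGradient_le_one _ _)
  have hZint := integrable_vectorDiv hZ hZc
  have hper : perimeter Ω ≤ ENNReal.ofReal (∫ x in Ω, vectorDiv Z x) := by
    refine perimeter_le_setIntegral_vectorDiv hr hR hΩ hs hZ hZc fun x h1 h2 => ?_
    have hx1 : r / 2 ≤ ‖x‖ := by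
      have := mul_gauge_le_norm_of_mem_starClass hr hΩ x
      nlinarith
    have hx2 : ‖x‖ ≤ 2 * R := by
      have := norm_le_mul_gauge hr hR hΩ x
      nlinarith
    rw [hZdef]
    simp only
    rw [hη1 x hx1 hx2, one_smul, hX, inner_gradient_unitGradient]
  have hper' : ENNReal.ofReal (∫ x in Ω', vectorDiv Z x) ≤ perimeter Ω' :=
    le_iSup_of_le Z (le_iSup_of_le hZ (le_iSup_of_le hZc (le_iSup_of_le hZ1 le_rfl)))
  -- On the set where `Ω` and `Ω'` differ, the cutoff is identically one.
  set S := gaugeShell Ω (1 + δ)⁻¹ (1 + δ) ∩ {x | r / 2 < ‖x‖ ∧ ‖x‖ < 2 * R} with hS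
  have hSopen : IsOpen {x : EuclideanSpace ℝ (Fin n) | r / 2 < ‖x‖ ∧ ‖x‖ < 2 * R} :=
    (isOpen_lt continuous_const continuous_norm).inter (isOpen_lt continuous_norm continuous_const)
  have hSmeas : MeasurableSet S :=
    (measurableSet_gaugeShell hr hΩ _ _).inter hSopen.measurableSet
  have hmemS : ∀ x, ((x ∈ Ω ∧ x ∉ Ω') ∨ (x ∈ Ω' ∧ x ∉ Ω)) → x ∈ S := by
    intro x hx
    refine ⟨mem_gaugeShell_of_mem_symmDiff hr hΩ hΩ' hδ hd hx, ?_⟩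
    have aux : ∀ {A B : Set (EuclideanSpace ℝ (Fin n))}, A ∈ starClass n r R →
        B ∈ starClass n r R → x ∈ A → x ∉ B → r / 2 < ‖x‖ ∧ ‖x‖ < 2 * R := by
      intro A B hA hB hxA hxB
      have h1 : ‖x‖ < R := mem_ball_zero_iff.1 (hA.2 hxA)
      have h2 : r ≤ ‖x‖ := by
        by_contra! hlt
        exact hxB (ball_subset_of_mem_starClass hB (mem_ball_zero_iff.2 hlt))
      constructor <;> linarith
    exact hx.elim (fun h => aux hΩ hΩ' h.1 h.2) (fun h => aux hΩ' hΩ h.1 h.2)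
  have hnull : ∀ {A : Set (EuclideanSpace ℝ (Fin n))}, A ∈ starClass n r R →
      NullMeasurableSet A volume := fun {A} hA =>
    ((isOpen_lt (continuous_gauge_of_mem_starClass hr hA)
      continuous_const).measurableSet.nullMeasurableSet).congr (ae_eq_interior hr hA).symm
  have hreal : ∫ x in Ω, vectorDiv Z x ≤
      (∫ x in Ω', vectorDiv Z x) + ∫ x in S, ‖vectorDiv Z x‖ := by
    rw [← integral_indicator₀ (hnull hΩ), ← integral_indicator₀ (hnull hΩ'),
      ← integral_indicator hSmeas,
      ← integral_add (hZint.indicator₀ (hnull hΩ')) (hZint.norm.indicator hSmeas)]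
    refine integral_mono (hZint.indicator₀ (hnull hΩ))
      ((hZint.indicator₀ (hnull hΩ')).add (hZint.norm.indicator hSmeas)) fun x => ?_
    have hnn : 0 ≤ S.indicator (fun x => ‖vectorDiv Z x‖) x :=
      indicator_nonneg (fun _ _ => norm_nonneg _) x
    by_cases hx : x ∈ Ω <;> by_cases hx' : x ∈ Ω'
    · simp only [indicator_of_mem hx, indicator_of_mem hx']
      linarith
    · simp only [indicator_of_mem hx, indicator_of_notMem hx',
        indicator_of_mem (hmemS x (Or.inl ⟨hx, hx'⟩)), zero_add]
      exact Real.le_norm_self _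
    · simp only [indicator_of_notMem hx, indicator_of_mem hx',
        indicator_of_mem (hmemS x (Or.inr ⟨hx', hx⟩))]
      have := neg_le_abs (vectorDiv Z x)
      rw [Real.norm_eq_abs]
      linarith
    · simp only [indicator_of_notMem hx, indicator_of_notMem hx']
      linarith
  calc perimeter Ω ≤ ENNReal.ofReal (∫ x in Ω, vectorDiv Z x) := hper
    _ ≤ ENNReal.ofReal (∫ x in Ω', vectorDiv Z x) +
          ENNReal.ofReal (∫ x in S, ‖vectorDiv Z x‖) :=
        (ENNReal.ofReal_le_ofReal hreal).trans ENNReal.ofReal_add_le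
    _ ≤ _ := by
        refine add_le_add hper' ?_
        rw [ofReal_integral_norm_eq_lintegral_enorm hZint.restrict]
        refine (setLIntegral_mono_ae' hSmeas (Filter.Eventually.of_forall fun x hx => ?_)).trans
          (lintegral_mono_set inter_subset_left)
        have hev : Z =ᶠ[𝓝 x] X := by
          filter_upwards [hSopen.mem_nhds hx.2] with y hy
          rw [hZdef]
          simp only
          rw [hη1 y hy.1.le hy.2.le, one_smul]
        rw [vectorDiv_congr hev]

end PerimeterComparison

/-! ### Integration in time -/

section TimeIntegral

variable {n : ℕ} {r R : ℝ}

lemma hausdorffDist_le_of_mem_starClass (hr : 0 < r) (hrR : r < R)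
    {Ω Ω' : Set (EuclideanSpace ℝ (Fin n))} (hΩ : Ω ∈ starClass n r R)
    (hΩ' : Ω' ∈ starClass n r R) : Metric.hausdorffDist Ω Ω' ≤ R := by
  have aux : ∀ {A B : Set (EuclideanSpace ℝ (Fin n))}, A ∈ starClass n r R →
      B ∈ starClass n r R → ∀ x ∈ A, ∃ y ∈ B, dist x y ≤ R := fun {A B} hA hB x hx =>
    ⟨0, ball_subset_of_mem_starClass hB (Metric.mem_ball_self hr),
      (Metric.mem_ball.1 (hA.2 hx)).le⟩
  exact Metric.hausdorffDist_le_of_mem_dist (hr.trans hrR).le (aux hΩ hΩ') (aux hΩ' hΩ)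

/-- The perimeters of two families whose Hausdorff distance is uniformly less than `δ * r` have time
integrals differing by `O(δ)`, with a constant that is linear in the total curvature energy. -/
lemma exists_lintegral_perimeter_le (hn : 2 ≤ n) (hr : 0 < r) (hrR : r < R) (K : ℝ) :
    ∃ C : ℝ≥0∞, C ≠ ⊤ ∧ ∀ (T : ℝ) (A B : ℝ → Set (EuclideanSpace ℝ (Fin n))) (δ : ℝ),
      (∀ t ∈ Ioc 0 T, A t ∈ starClass n r R) → (∀ t ∈ Ioc 0 T, B t ∈ starClass n r R) →
      (∀ t ∈ Ioc 0 T, HasSmoothBoundary (A t)) →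
      AEMeasurable (fun t => perimeter (B t)) (volume.restrict (Ioc 0 T)) →
      0 < δ → δ ≤ K → (∀ t ∈ Ioc 0 T, Metric.hausdorffDist (A t) (B t) < δ * r) →
      ∫⁻ t in Ioc 0 T, perimeter (A t) ≤ (∫⁻ t in Ioc 0 T, perimeter (B t)) +
        ENNReal.ofReal δ * C * (ENNReal.ofReal T + ∫⁻ t in Ioc 0 T, curvatureEnergy (A t)) := by
  obtain ⟨C, hC, hCle⟩ := exists_lintegral_vectorDiv_shell_le hn hr (hr.trans hrR) K
  refine ⟨C, hC, fun T A B δ hA hB hs hBm hδ hδK hd => ?_⟩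
  have hfin : ENNReal.ofReal δ * C ≠ ⊤ := ENNReal.mul_ne_top ENNReal.ofReal_ne_top hC
  calc ∫⁻ t in Ioc 0 T, perimeter (A t)
      ≤ ∫⁻ t in Ioc 0 T, (perimeter (B t) +
          ENNReal.ofReal δ * C * (1 + curvatureEnergy (A t))) :=
        setLIntegral_mono' measurableSet_Ioc fun t ht =>
          (perimeter_le_perimeter_add hr hrR (hA t ht) (hB t ht) (hs t ht) hδ (hd t ht)).trans
            (add_le_add le_rfl (hCle (A t) (hA t ht) (hs t ht) δ hδ hδK))
    _ = _ := by
        rw [lintegral_add_left' hBm, lintegral_const_mul' _ _ hfin,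
          lintegral_add_left measurable_const, setLIntegral_one, Real.volume_Ioc, sub_zero]

end TimeIntegral

theorem mainTheorem8 (n : ℕ) (hn : 2 ≤ n) (r R T W : ℝ) (hr : 0 < r) (hrR : r < R) (hT : 0 < T) :
    ∃ m : ℝ, 0 < m ∧
      ∀ Ω : Fin 2 → ℝ → Set (EuclideanSpace ℝ (Fin n)),
        (∀ j, ∀ t ∈ Icc 0 T, Ω j t ∈ starClass n r R) →
        (∀ j, ∀ t ∈ Ioc 0 T, HasSmoothBoundary (Ω j t)) →
        (∀ j, AEMeasurable (fun t => perimeter (Ω j t)) (volume.restrict (Ioc 0 T))) →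
        (∀ j, (∫⁻ t in Ioc 0 T, curvatureEnergy (Ω j t)) < ENNReal.ofReal W) →
          (∀ j, ∀ t ∈ Ioc 0 T, perimeter (Ω j t) ≠ ⊤) ∧
          (∀ j, IntervalIntegrable (fun t => (perimeter (Ω j t)).toReal) volume 0 T) ∧
          (∫ t in (0 : ℝ)..T, ((perimeter (Ω 0 t)).toReal - (perimeter (Ω 1 t)).toReal)) ^ 2 ≤
            m * ⨆ t : Icc (0 : ℝ) T, Metric.hausdorffDist (Ω 0 t) (Ω 1 t) := by
  have hR : 0 < R := hr.trans hrR
  obtain ⟨M, hM, hMle⟩ := exists_perimeter_le n hr hR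
  obtain ⟨C, hC, hCle⟩ := exists_lintegral_perimeter_le hn hr hrR (R / r + 1)
  set Q : ℝ := C.toReal * (T + W) with hQ
  refine ⟨Q ^ 2 * R / r ^ 2 + 1, by positivity, fun Ω hΩ hs hm hW => ?_⟩
  have hIcc : ∀ {t}, t ∈ Ioc 0 T → t ∈ Icc 0 T := fun ht => Ioc_subset_Icc_self ht
  have hle : ∀ j, ∀ t ∈ Ioc 0 T, perimeter (Ω j t) ≤ M := fun j t ht =>
    hMle _ (hΩ j t (hIcc ht)) (hs j t ht)
  have hne : ∀ j, ∀ t ∈ Ioc 0 T, perimeter (Ω j t) ≠ ⊤ := fun j t ht =>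
    ((hle j t ht).trans_lt hM.lt_top).ne
  have hlin : ∀ j, ∫⁻ t in Ioc 0 T, perimeter (Ω j t) ≠ ⊤ := fun j => by
    refine ((setLIntegral_mono' measurableSet_Ioc (hle j)).trans_lt ?_).ne
    rw [setLIntegral_const, Real.volume_Ioc]
    exact ENNReal.mul_lt_top hM.lt_top ENNReal.ofReal_lt_top
  have hint : ∀ j, IntegrableOn (fun t => (perimeter (Ω j t)).toReal) (Ioc 0 T) := fun j =>
    integrable_toReal_of_lintegral_ne_top (hm j) (hlin j)
  refine ⟨hne, fun j => (intervalIntegrable_iff_integrableOn_Ioc_of_le hT.le).2 (hint j), ?_⟩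
  set D : ℝ := ⨆ t : Icc (0 : ℝ) T, Metric.hausdorffDist (Ω 0 t) (Ω 1 t) with hD
  have hdR : ∀ t : Icc (0 : ℝ) T, Metric.hausdorffDist (Ω 0 t) (Ω 1 t) ≤ R := fun t =>
    hausdorffDist_le_of_mem_starClass hr hrR (hΩ 0 t t.2) (hΩ 1 t t.2)
  have hdD : ∀ t ∈ Icc 0 T, Metric.hausdorffDist (Ω 0 t) (Ω 1 t) ≤ D := fun t ht =>
    le_ciSup (f := fun t : Icc (0 : ℝ) T => Metric.hausdorffDist (Ω 0 t) (Ω 1 t))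
      ⟨R, by rintro _ ⟨t, rfl⟩; exact hdR t⟩ ⟨t, ht⟩
  have hD0 : 0 ≤ D := Metric.hausdorffDist_nonneg.trans (hdD 0 ⟨le_rfl, hT.le⟩)
  have hDR : D ≤ R := by
    have : Nonempty (Icc (0 : ℝ) T) := ⟨⟨0, le_rfl, hT.le⟩⟩
    exact ciSup_le hdR
  have hW0 : 0 < W := ENNReal.ofReal_pos.1 (bot_le.trans_lt (hW 0))
  have hQ0 : 0 ≤ Q := by positivity
  have hI : ∀ j, ∫ t in Ioc 0 T, (perimeter (Ω j t)).toReal =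
      (∫⁻ t in Ioc 0 T, perimeter (Ω j t)).toReal := fun j =>
    integral_toReal (hm j) ((ae_restrict_mem measurableSet_Ioc).mono fun t ht =>
      (hne j t ht).lt_top)
  -- The one-sided estimate for a thickness `δ > D / r`.
  have hone : ∀ i j, (∀ t ∈ Icc 0 T, Metric.hausdorffDist (Ω i t) (Ω j t) ≤ D) →
      ∀ δ, D / r < δ → δ < R / r + 1 →
      ∫ t in Ioc 0 T, (perimeter (Ω i t)).toReal ≤
        (∫ t in Ioc 0 T, (perimeter (Ω j t)).toReal) + δ * Q := by
    intro i j hij δ hδ hδK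
    have hδ0 : 0 < δ := lt_of_le_of_lt (by positivity) hδ
    have h1 := hCle T (Ω i) (Ω j) δ (fun t ht => hΩ i t (hIcc ht)) (fun t ht => hΩ j t (hIcc ht))
      (hs i) (hm j) hδ0 hδK.le
      (fun t ht => (hij t (hIcc ht)).trans_lt ((div_lt_iff₀ hr).1 hδ))
    have h2 : ENNReal.ofReal δ * C *
        (ENNReal.ofReal T + ∫⁻ t in Ioc 0 T, curvatureEnergy (Ω i t)) ≤
        ENNReal.ofReal (δ * Q) := by
      rw [hQ, ← mul_assoc, ENNReal.ofReal_mul (by positivity), ENNReal.ofReal_mul hδ0.le,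
        ENNReal.ofReal_toReal hC, ENNReal.ofReal_add hT.le hW0.le]
      gcongr
      exact (hW i).le
    rw [hI i, hI j]
    refine (ENNReal.toReal_mono (ENNReal.add_ne_top.2 ⟨hlin j, ENNReal.ofReal_ne_top⟩)
      (h1.trans (add_le_add le_rfl h2))).trans_eq ?_
    rw [ENNReal.toReal_add (hlin j) ENNReal.ofReal_ne_top, ENNReal.toReal_ofReal (by positivity)]
  set J := ∫ t in (0 : ℝ)..T, ((perimeter (Ω 0 t)).toReal - (perimeter (Ω 1 t)).toReal) with hJ
  have hJeq : J = (∫ t in Ioc 0 T, (perimeter (Ω 0 t)).toReal) -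
      ∫ t in Ioc 0 T, (perimeter (Ω 1 t)).toReal := by
    rw [hJ, intervalIntegral.integral_of_le hT.le]
    exact integral_sub (hint 0) (hint 1)
  have hJle : |J| ≤ D / r * Q := by
    have ht : Filter.Tendsto (fun δ : ℝ => δ * Q) (𝓝[>] (D / r)) (𝓝 (D / r * Q)) :=
      (Continuous.tendsto (by fun_prop) _).mono_left nhdsWithin_le_nhds
    have hlt : D / r < R / r + 1 := by
      have : D / r ≤ R / r := by gcongr
      linarith
    refine ge_of_tendsto ht ?_
    filter_upwards [Ioo_mem_nhdsGT hlt] with δ hδ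
    have h01 := hone 0 1 hdD δ hδ.1 hδ.2
    have h10 := hone 1 0 (fun t ht => by
      rw [Metric.hausdorffDist_comm]; exact hdD t ht) δ hδ.1 hδ.2
    rw [abs_le, hJeq]
    constructor <;> linarith
  calc J ^ 2 = |J| ^ 2 := (sq_abs J).symm
    _ ≤ (D / r * Q) ^ 2 := by gcongr
    _ = Q ^ 2 * D / r ^ 2 * D := by ring
    _ ≤ (Q ^ 2 * R / r ^ 2 + 1) * D := by
        gcongr
        have : Q ^ 2 * D / r ^ 2 ≤ Q ^ 2 * R / r ^ 2 := by gcongr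
        linarith
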